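/- For a finite-dimensional real space $E$ let $\mathcal S^{(1)}(E)$ be the Gelfand--Shilov space of Beurling type: all $f\in C^\infty(E)$ with $\|f\|_h=\sup_{p,q,x}\frac{|x^p\partial^q f(x)|}{h^{|p|+|q|}\,|p|!\,|q|!}<\infty$ for every $h>0$, with the projective limit topology given by the norms $\|\cdot\|_h$, and let $(\mathcal S^{(1)})'(E)$ be its topological dual. Let $\langle u,g\rangle=u(\overline g)$ be the extension of the $L^2$ inner product, antilinear in the second slot. For $f,g\in\mathcal S^{(1)}(\mathbb R^d)$ and $\tau\in[0,1]$ let $$V_gf(x,\omega)=\int_{\mathbb R^d}\overline{g(t-x)}\,e^{-2\pi i t\cdot\omega}f(t)\,dt,\qquad W_\tau(f,g)(x,\omega)=\int_{\mathbb R^d}e^{-2\pi i t\cdot\omega}f(x+\tau t)\,\overline{g(x-(1-\tau)t)}\,dt .$$ For $a\in(\mathcal S^{(1)})'(\mathbb R^{2d})$ and $\varphi_1,\varphi_2\in\mathcal S^{(1)}(\mathbb R^d)\setminus\{0\}$, the localization operator $A_a^{\varphi_1,\varphi_2}:\mathcal S^{(1)}(\mathbb R^d)\to(\mathcal S^{(1)})'(\mathbb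 R^d)$ is the continuous linear map with $$\langle A_a^{\varphi_1,\varphi_2}f,g\rangle=\langle a,\overline{V_{\varphi_1}f}\;V_{\varphi_2}g\rangle ,\qquad f,g\in\mathcal S^{(1)}(\mathbb R^d).$$ For $\sigma\in(\mathcal S^{(1)})'(\mathbb R^{2d})$, the $\tau$-quantization $\mathrm{Op}_\tau(\sigma):\mathcal S^{(1)}(\mathbb R^d)\to(\mathcal S^{(1)})'(\mathbb R^d)$ is given in the weak sense by $$\langle \mathrm{Op}_\tau(\sigma)f,g\rangle=\iiint e^{2\pi i(x-y)\cdot\omega}\,\sigma((1-\tau)x+\tau y,\omega)\,f(y)\,\overline{g(x)}\,dy\,d\omega\,dx ,$$ that is, after the substitution $p=(1-\tau)x+\tau y$, $s=x-y$, $\sigma$ is applied to the test function $(p,\omega)\mapsto\int e^{2\pi i s\cdot\omega}f(p-(1-\tau)s)\,\overline{g(p+\tau s)}\,ds$. The convolution $a*W\in(\mathcal S^{(1)})'(\mathbb R^{2d})$ of $a\in(\mathcal S^{(1)})'(\mathbb R^{2d})$ with $W\in\mathcal S^{(1)}(\mathbb R^{2d})$ is defined by $(a*W)(\Phi)=a\big(z\mapsto\int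 W(w-z)\Phi(w)\,dw\big)$ for all $\Phi\in\mathcal S^{(1)}(\mathbb R^{2d})$. Proposition. Let $\varphi_1,\varphi_2\in\mathcal S^{(1)}(\mathbb R^d)\setminus\{0\}$, $a\in(\mathcal S^{(1)})'(\mathbb R^{2d})$ and $\tau\in[0,1]$. Then $W_\tau(\varphi_2,\varphi_1)\in\mathcal S^{(1)}(\mathbb R^{2d})$, the objects $A_a^{\varphi_1,\varphi_2}$, $a*W_\tau(\varphi_2,\varphi_1)$ and $\mathrm{Op}_\tau(a*W_\tau(\varphi_2,\varphi_1))$ are well defined, and $$A_a^{\varphi_1,\varphi_2}=\mathrm{Op}_\tau\big(a*W_\tau(\varphi_2,\varphi_1)\big).$$ -/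

import Mathlib

open MeasureTheory
open scoped ContDiff Nat ComplexConjugate

noncomputable section

/-- The Euclidean space `ℝ^d`. The phase space `ℝ^{2d}` is `Rd d × Rd d`. -/
abbrev Rd (d : ℕ) : Type := EuclideanSpace ℝ (Fin d)

/-! ### The Gelfand-Shilov space `S^{(1)}` of Beurling type and its dual -/

section GelfandShilov

variable (E : Type*) [NormedAddCommGroup E] [NormedSpace ℝ E]

/-- The complex vector space of all smooth `f : E → ℂ` such that, for every `h > 0`,
`sup_{k,n,x} |x|^k |D^n f(x)| / (h^(k+n) k! n!) < ∞`. Here `D^n f` is the full `n`-th derivative and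
`|·|` any norm of the finite-dimensional space `E`. Passing to monomials `x^p` and partial
derivatives `∂^q` with `|p| = k`, `|q| = n`, or to an equivalent norm, changes each term by a factor
between `c^(k+n)` and `C^(k+n)` only, which is absorbed by a change of `h`. -/
def gelfandShilovSubmodule : Submodule ℂ (E → ℂ) where
  carrier := {f | ContDiff ℝ ∞ f ∧ ∀ h : ℝ, 0 < h → ∃ C : ℝ, ∀ (k n : ℕ) (x : E),
    ‖x‖ ^ k * ‖iteratedFDeriv ℝ n f x‖ ≤ C * (h ^ (k + n) * k ! * n !)}
  zero_mem' := by
    refine ⟨contDiff_const, fun h _ => ⟨0, fun k n x => ?_⟩⟩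
    simp
  add_mem' := by
    rintro f g ⟨hf, hf'⟩ ⟨hg, hg'⟩
    refine ⟨hf.add hg, fun h hh => ?_⟩
    obtain ⟨C, hC⟩ := hf' h hh
    obtain ⟨D, hD⟩ := hg' h hh
    refine ⟨C + D, fun k n x => ?_⟩
    rw [iteratedFDeriv_add_apply (hf.contDiffAt.of_le (mod_cast le_top))
      (hg.contDiffAt.of_le (mod_cast le_top)), add_mul]
    refine le_trans ?_ (add_le_add (hC k n x) (hD k n x))
    rw [← mul_add]
    gcongr
    exact norm_add_le _ _
  smul_mem' := by
    rintro c f ⟨hf, hf'⟩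
    refine ⟨contDiff_const.smul hf, fun h hh => ?_⟩
    obtain ⟨C, hC⟩ := hf' h hh
    refine ⟨‖c‖ * C, fun k n x => ?_⟩
    rw [iteratedFDeriv_const_smul_apply (hf.contDiffAt.of_le (mod_cast le_top)), norm_smul,
      mul_left_comm, mul_assoc]
    exact mul_le_mul_of_nonneg_left (hC k n x) (norm_nonneg c)

/-- The Gelfand-Shilov space `S^{(1)}(E)`. -/
def GelfandShilov : Type _ := gelfandShilovSubmodule E

namespace GelfandShilov

instance : AddCommGroup (GelfandShilov E) :=
  inferInstanceAs (AddCommGroup (gelfandShilovSubmodule E))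

instance : Module ℂ (GelfandShilov E) :=
  inferInstanceAs (Module ℂ (gelfandShilovSubmodule E))

instance : FunLike (GelfandShilov E) E ℂ where
  coe f := f.1
  coe_injective := fun _ _ hfg => Subtype.ext hfg

variable {E}

theorem coe_add (f g : GelfandShilov E) : ⇑(f + g) = ⇑f + ⇑g := rfl

theorem coe_smul (c : ℂ) (f : GelfandShilov E) : ⇑(c • f) = c • ⇑f := rfl

theorem coe_zero : ⇑(0 : GelfandShilov E) = 0 := rfl

theorem contDiff (f : GelfandShilov E) : ContDiff ℝ ∞ f := f.2.1

/-- The quotient whose supremum over all `k, n, x` is the `h`-th norm of `f`. -/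
def quotient (h : ℝ) (f : GelfandShilov E) (z : ℕ × ℕ × E) : ℝ :=
  ‖z.2.2‖ ^ z.1 * ‖iteratedFDeriv ℝ z.2.1 f z.2.2‖ / (h ^ (z.1 + z.2.1) * z.1 ! * z.2.1 !)

theorem quotient_bddAbove {h : ℝ} (hh : 0 < h) (f : GelfandShilov E) :
    BddAbove (Set.range (quotient h f)) := by
  obtain ⟨C, hC⟩ := f.2.2 h hh
  refine ⟨C, ?_⟩
  rintro _ ⟨⟨k, n, x⟩, rfl⟩
  rw [quotient, div_le_iff₀ (by positivity)]
  exact hC k n x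

/-- The norm `‖f‖_h = sup_{k,n,x} |x|^k |D^n f(x)| / (h^(k+n) k! n!)` on `S^{(1)}(E)`. -/
def hNorm (h : {h : ℝ // 0 < h}) : Seminorm ℂ (GelfandShilov E) :=
  Seminorm.ofSMulLE (fun f => ⨆ z, quotient h.1 f z)
    (by simp [quotient, coe_zero])
    (fun f g => by
      refine ciSup_le fun z => ?_
      refine le_trans ?_ (add_le_add (le_ciSup (quotient_bddAbove h.2 f) z)
        (le_ciSup (quotient_bddAbove h.2 g) z))
      have hh := h.2
      rw [quotient, quotient, quotient, ← add_div, ← mul_add, coe_add,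
        iteratedFDeriv_add_apply (f.contDiff.contDiffAt.of_le (mod_cast le_top))
          (g.contDiff.contDiffAt.of_le (mod_cast le_top))]
      gcongr
      exact norm_add_le _ _)
    (fun c f => by
      refine ciSup_le fun z => ?_
      refine le_trans (le_of_eq ?_) (mul_le_mul_of_nonneg_left
        (le_ciSup (quotient_bddAbove h.2 f) z) (norm_nonneg c))
      rw [quotient, quotient, coe_smul,
        iteratedFDeriv_const_smul_apply (f.contDiff.contDiffAt.of_le (mod_cast le_top)), norm_smul]
      ring)

variable (E) in
/-- The family of all norms `‖·‖_h`, `h > 0`. -/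
def normFamily : SeminormFamily ℂ (GelfandShilov E) {h : ℝ // 0 < h} := hNorm

instance : Nonempty {h : ℝ // 0 < h} := ⟨⟨1, one_pos⟩⟩

/-- The projective limit topology, i.e. the topology defined by the norms `‖·‖_h`, `h > 0`. -/
instance : TopologicalSpace (GelfandShilov E) :=
  (normFamily E).moduleFilterBasis.topology'

theorem withSeminorms : WithSeminorms (normFamily E) := ⟨rfl⟩

instance : IsTopologicalAddGroup (GelfandShilov E) :=
  (normFamily E).addGroupFilterBasis.isTopologicalAddGroup

instance : ContinuousSMul ℂ (GelfandShilov E) :=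
  (normFamily E).moduleFilterBasis.continuousSMul

/-- The complex conjugate of a test function. -/
def conjugate (f : GelfandShilov E) : GelfandShilov E :=
  ⟨fun x => conj (f x), Complex.conjCLE.contDiff.comp f.contDiff, fun h hh => by
    obtain ⟨C, hC⟩ := f.2.2 h hh
    refine ⟨C, fun k n x => ?_⟩
    have := Complex.conjLIE.norm_iteratedFDeriv_comp_left (𝕜 := ℝ) (f : E → ℂ) x n
    have e : (Complex.conjLIE ∘ (f : E → ℂ)) = fun x => conj (f x) := rfl
    rw [e] at this
    rw [this]
    exact hC k n x⟩

end GelfandShilov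

/-- The space `(S^{(1)})'(E)` of tempered ultradistributions: the topological dual of `S^{(1)}(E)`,
with its strong topology. -/
abbrev UltraDistribution : Type _ := StrongDual ℂ (GelfandShilov E)

variable {E}

/-- The bracket `⟨u, g⟩`, linear in `u` and antilinear in `g`, that extends the `L²` inner product
`∫ u(x) conj(g(x)) dx`. -/
def bracket (u : UltraDistribution E) (g : GelfandShilov E) : ℂ := u g.conjugate

/-- `σ` is the convolution `a ∗ W` of the ultradistribution `a` with the test function `W`:
`σ(Φ) = a(Ψ)` for all test functions `Φ`, where `Ψ(z) = ∫ W(w - z) Φ(w) dw` is required to be a test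
function. (For a function `a`, this is the integral of `(a ∗ W) Φ`.) -/
def IsConvolution [MeasureSpace E] (a : UltraDistribution E) (W : GelfandShilov E)
    (σ : UltraDistribution E) : Prop :=
  ∀ Φ : GelfandShilov E, ∃ Ψ : GelfandShilov E,
    (∀ z, Ψ z = ∫ w, W (w - z) * Φ w) ∧ σ Φ = a Ψ

end GelfandShilov

/-! ### Time-frequency representations -/

section TimeFrequency

variable {d : ℕ}

/-- The short-time Fourier transform
`V_g f(x, ξ) = ∫ conj(g(t - x)) e^{-2πi t·ξ} f(t) dt`. -/
def stft (g f : Rd d → ℂ) (x ξ : Rd d) : ℂ :=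
  ∫ t, conj (g (t - x)) * Complex.exp (-(2 * Real.pi * Complex.I * (inner ℝ t ξ : ℝ))) * f t

/-- The cross-`τ`-Wigner distribution
`W_τ(f, g)(x, ξ) = ∫ e^{-2πi t·ξ} f(x + τ t) conj(g(x - (1 - τ) t)) dt`. -/
def tauWigner (τ : ℝ) (f g : Rd d → ℂ) (x ξ : Rd d) : ℂ :=
  ∫ t, Complex.exp (-(2 * Real.pi * Complex.I * (inner ℝ t ξ : ℝ))) *
    f (x + τ • t) * conj (g (x - (1 - τ) • t))

/-- `A` is the localization operator `A_a^{φ₁,φ₂} : S^{(1)}(ℝ^d) → (S^{(1)})'(ℝ^d)`: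
`⟨A f, g⟩ = ⟨a, conj(V_{φ₁} f) · V_{φ₂} g⟩` for all test functions `f, g`, the function in the right
bracket being a test function on `ℝ^{2d}`. -/
def IsLocalizationOperator (a : UltraDistribution (Rd d × Rd d)) (φ₁ φ₂ : GelfandShilov (Rd d))
    (A : GelfandShilov (Rd d) →L[ℂ] UltraDistribution (Rd d)) : Prop :=
  ∀ f g : GelfandShilov (Rd d), ∃ Ψ : GelfandShilov (Rd d × Rd d),
    (∀ x ξ, Ψ (x, ξ) = conj (stft φ₁ f x ξ) * stft φ₂ g x ξ) ∧
      bracket (A f) g = bracket a Ψ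

/-- `B` is the `τ`-quantization `Op_τ(σ) : S^{(1)}(ℝ^d) → (S^{(1)})'(ℝ^d)`, given in the weak sense by
`⟨B f, g⟩ = ∫∫∫ e^{2πi (x-y)·ξ} σ((1-τ)x + τy, ξ) f(y) conj(g(x)) dy dξ dx`.
For an ultradistribution `σ` the integral is read, after the substitution `p = (1-τ)x + τy`,
`s = x - y` of Jacobian one, i.e. `x = p + τ s`, `y = p - (1-τ) s`, as `σ` applied to
`(p, ξ) ↦ ∫ e^{2πi s·ξ} f(p - (1-τ)s) conj(g(p + τ s)) ds`, which is required to be a test function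
on `ℝ^{2d}`. -/
def IsTauQuantization (τ : ℝ) (σ : UltraDistribution (Rd d × Rd d))
    (B : GelfandShilov (Rd d) →L[ℂ] UltraDistribution (Rd d)) : Prop :=
  ∀ f g : GelfandShilov (Rd d), ∃ Ψ : GelfandShilov (Rd d × Rd d),
    (∀ p ξ, Ψ (p, ξ) = ∫ s, Complex.exp (2 * Real.pi * Complex.I * (inner ℝ s ξ : ℝ)) *
      f (p - (1 - τ) • s) * conj (g (p + τ • s))) ∧
      bracket (B f) g = σ Ψ

end TimeFrequency

/-! ### The objects described above are unique -/

theorem GelfandShilov.conjugate_conjugate {E : Type*} [NormedAddCommGroup E] [NormedSpace ℝ E]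
    (f : GelfandShilov E) : f.conjugate.conjugate = f :=
  DFunLike.ext _ _ fun x => Complex.conj_conj (f x)

theorem eq_of_bracket_eq {E : Type*} [NormedAddCommGroup E] [NormedSpace ℝ E]
    {u v : UltraDistribution E} (h : ∀ g, bracket u g = bracket v g) : u = v := by
  ext g
  simpa [bracket, GelfandShilov.conjugate_conjugate] using h g.conjugate

theorem IsConvolution.unique {E : Type*} [NormedAddCommGroup E] [NormedSpace ℝ E] [MeasureSpace E]
    {a σ σ' : UltraDistribution E} {W : GelfandShilov E}
    (h : IsConvolution a W σ) (h' : IsConvolution a W σ') : σ = σ' := by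
  ext Φ
  obtain ⟨Ψ, hΨ, e⟩ := h Φ
  obtain ⟨Ψ', hΨ', e'⟩ := h' Φ
  rw [e, e', DFunLike.ext Ψ Ψ' fun z => (hΨ z).trans (hΨ' z).symm]

theorem IsLocalizationOperator.unique {d : ℕ} {a : UltraDistribution (Rd d × Rd d)}
    {φ₁ φ₂ : GelfandShilov (Rd d)} {A A' : GelfandShilov (Rd d) →L[ℂ] UltraDistribution (Rd d)}
    (h : IsLocalizationOperator a φ₁ φ₂ A) (h' : IsLocalizationOperator a φ₁ φ₂ A') : A = A' := by
  refine ContinuousLinearMap.ext fun f => eq_of_bracket_eq fun g => ?_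
  obtain ⟨Ψ, hΨ, e⟩ := h f g
  obtain ⟨Ψ', hΨ', e'⟩ := h' f g
  have hΨΨ' : Ψ = Ψ' := DFunLike.ext _ _ fun ⟨x, ξ⟩ => (hΨ x ξ).trans (hΨ' x ξ).symm
  rw [e, e', hΨΨ']

theorem IsTauQuantization.unique {d : ℕ} {τ : ℝ} {σ : UltraDistribution (Rd d × Rd d)}
    {B B' : GelfandShilov (Rd d) →L[ℂ] UltraDistribution (Rd d)}
    (h : IsTauQuantization τ σ B) (h' : IsTauQuantization τ σ B') : B = B' := by
  refine ContinuousLinearMap.ext fun f => eq_of_bracket_eq fun g => ?_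
  obtain ⟨Ψ, hΨ, e⟩ := h f g
  obtain ⟨Ψ', hΨ', e'⟩ := h' f g
  have hΨΨ' : Ψ = Ψ' := DFunLike.ext _ _ fun ⟨x, ξ⟩ => (hΨ x ξ).trans (hΨ' x ξ).symm
  rw [e, e', hΨΨ']

end

/-! The heart of the matter is Moyal's identity `correlation_wigner`: the correlation of W_τ(φ₂, φ₁)
with conj W_τ(g, f) is V_{φ₁}f · conj V_{φ₂}g. By `conjugate_wigner_apply`, conj W_τ(g, f) is
exactly the test function to which the symbol is applied in the weak definition of Op_τ. Applying a
* W_τ(φ₂, φ₁) to it therefore means applying a to V_{φ₁}f · conj V_{φ₂}g, which is ⟨A_a f, g⟩.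

To prove Moyal's identity, fix the position variable p. As functions of frequency, the two Wigner
factors are a Fourier transform of a modulated product and an inverse Fourier transform, so Parseval
(`integral_fourier_mul_fourierInv`) removes the frequency integral. The substitution y = p - (1-τ)t,
r = p + τt has Jacobian one and splits the remaining double integral into the two short-time Fourier
transforms (`integral_integral_mul_shear`).

The analytic work lies in showing that all these functions belong to S^{(1)} and that the
functionals are continuous. Each function is built from linear substitutions, products
(`Bound.mul_comp`) and a partial Fourier transform (`exists_bound_partialFourier`). For each of
these, every target h admits an h' such that an h'-bound with constant A yields an h-bound with
constant C·A. This linear dependence on A gives membership and continuity at once.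

For the partial Fourier transform, derivatives of the output become moments and derivatives of the
input, and moments in frequency become derivatives by integration by parts. The resulting
commutators are absorbed by controlling the input with one sequence M_{k+n} satisfying (N+1) M_N ≤
M_{N+2}. -/

noncomputable section

open scoped SchwartzMap

/-! ### Partial Fourier transform of Schwartz functions: differentiation and integration by parts -/

namespace PartialFourier

variable {E F W V : Type} [NormedAddCommGroup E] [NormedSpace ℝ E]
  [NormedAddCommGroup F] [NormedSpace ℝ F] [NormedAddCommGroup W] [NormedSpace ℝ W]
  [NormedAddCommGroup V] [NormedSpace ℝ V] [NormedSpace ℂ V] [IsScalarTower ℝ ℂ V]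
  (L : F →L[ℝ] W →L[ℝ] ℝ)

/-- The partial Fourier transform `(x, w) ↦ ∫ e^{-2πi L(t, w)} H(x, t) dt` with respect to the
pairing `L`. -/
def partialFourier [MeasurableSpace F] (μ : Measure F) (H : E × F → V) (z : E × W) : V :=
  ∫ t, Real.fourierChar (-(L t z.2)) • H (z.1, t) ∂μ

variable (E) in
/-- The bilinear form `((x, t), (a, w)) ↦ L(t, w)`. -/
def phase : (E × F) →L[ℝ] (E × W) →L[ℝ] ℝ :=
  (ContinuousLinearMap.precomp ℝ (ContinuousLinearMap.snd ℝ E W)).comp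
    (L.comp (ContinuousLinearMap.snd ℝ E F))

@[simp]
theorem phase_apply (p : E × F) (z : E × W) : phase E L p z = L p.2 z.2 := rfl

variable (E F W) in
/-- The map `(a, w) ↦ (a, 0)`. -/
def baseIncl : (E × W) →L[ℝ] (E × F) :=
  (ContinuousLinearMap.inl ℝ E F).comp (ContinuousLinearMap.fst ℝ E W)

@[simp]
theorem baseIncl_apply (z : E × W) : baseIncl E F W z = (z.1, 0) := rfl

theorem norm_baseIncl_le : ‖baseIncl E F W‖ ≤ 1 :=
  ContinuousLinearMap.opNorm_le_bound _ zero_le_one fun z => by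
    simp [Prod.norm_def]

/-- The function whose partial Fourier transform is the derivative of that of `H`. -/
def derivSymbol (H : 𝓢(E × F, V)) : 𝓢(E × F, (E × W) →L[ℝ] V) :=
  SchwartzMap.postcompCLM (𝕜 := ℝ) (ContinuousLinearMap.precomp V (baseIncl E F W))
      (SchwartzMap.fderivCLM ℝ _ _ H) +
    (-(2 * Real.pi * Complex.I) : ℂ) • SchwartzMap.smulRightCLM ℝ V (phase E L) H

theorem derivSymbol_apply (H : 𝓢(E × F, V)) (p : E × F) :
    derivSymbol L H p = (fderiv ℝ H p).comp (baseIncl E F W) +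
      (-(2 * Real.pi * Complex.I) : ℂ) • (phase E L p).smulRight (H p) := rfl

/-- Product rule: the base variable differentiates H, while the frequency variable differentiates
the character and brings down -2πi L(t, ·). Both contributions carry the same character, so the
derivative is again an integrand of partial Fourier type. -/
theorem hasFDerivAt_char_smul (H : 𝓢(E × F, V)) (t : F) (y : E × W) :
    HasFDerivAt (fun z : E × W => Real.fourierChar (-(L t z.2)) • H (z.1, t))
      (Real.fourierChar (-(L t y.2)) • derivSymbol L H (y.1, t)) y := by
  have h1 := Real.hasFDerivAt_fourierChar_neg_bilinear_right (phase E L) (0, t) y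
  have h3 : HasFDerivAt (fun z : E × W => (z.1, t)) (baseIncl E F W) y := by
    have h := ((baseIncl E F W).hasFDerivAt (x := y)).add_const ((0 : E), t)
    have e : (fun z : E × W => (baseIncl E F W) z + ((0 : E), t)) = fun z => (z.1, t) := by
      funext z; simp
    rwa [e] at h
  have h2 : HasFDerivAt (fun z : E × W => H (z.1, t))
      ((fderiv ℝ H (y.1, t)).comp (baseIncl E F W)) y :=
    HasFDerivAt.comp (g := H) y (H.hasFDerivAt (y.1, t)) h3
  refine (h1.fun_smul h2).congr_fderiv ?_
  refine ContinuousLinearMap.ext fun w => ?_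
  rw [derivSymbol_apply]
  simp only [Circle.smul_def, _root_.add_apply, _root_.smul_apply,
    ContinuousLinearMap.smulRight_apply, ContinuousLinearMap.comp_apply, phase_apply, smul_add,
    Complex.ofRealCLM_apply]
  congr 1
  rw [← algebraMap_smul ℂ (L t w.2), smul_smul, smul_smul, smul_eq_mul, Complex.coe_algebraMap]
  congr 1
  ring

section Decay

theorem continuous_char (w : W) : Continuous fun t => Real.fourierChar (-(L t w)) :=
  Real.continuous_fourierChar.comp (L.flip w).continuous.neg

variable [FiniteDimensional ℝ F] [MeasurableSpace F] [BorelSpace F]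
  (μ : Measure F) [μ.IsAddHaarMeasure]

/-- The Schwartz seminorms of order 0 and `μ.integrablePower` give decay in t uniformly in x. This
is the dominating function for differentiation under the integral. -/
theorem exists_integrable_bound (H : 𝓢(E × F, V)) :
    ∃ B : F → ℝ, Integrable B μ ∧ ∀ x t, ‖H (x, t)‖ ≤ B t := by
  obtain ⟨C₁, h₁⟩ := H.decay' 0 0
  obtain ⟨C₂, h₂⟩ := H.decay' μ.integrablePower 0
  refine ⟨fun t => 2 ^ μ.integrablePower * (C₁ + C₂) * (1 + ‖t‖) ^ (-(μ.integrablePower : ℝ)),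
    (Measure.integrable_pow_neg_integrablePower μ).const_mul _, fun x t => ?_⟩
  have := pow_mul_le_of_le_of_pow_mul_le (k := 0) (l := μ.integrablePower) (x := ‖t‖)
    (norm_nonneg _) (norm_nonneg (H (x, t))) (C₁ := C₁) (C₂ := C₂)
    (by
      have := h₁ (x, t)
      rwa [norm_iteratedFDeriv_zero, pow_zero, one_mul] at this)
    (by
      refine le_trans ?_ (h₂ (x, t))
      rw [zero_add, norm_iteratedFDeriv_zero]
      exact mul_le_mul_of_nonneg_right (pow_le_pow_left₀ (norm_nonneg _) (norm_snd_le (x, t)) _)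
        (norm_nonneg _))
  simpa using this

theorem integrable_slice (H : 𝓢(E × F, V)) (x : E) : Integrable (fun t => H (x, t)) μ := by
  obtain ⟨B, hB, h⟩ := exists_integrable_bound μ H
  exact hB.mono' (H.continuous.comp (by fun_prop)).aestronglyMeasurable (ae_of_all _ (h x))

theorem integrable_char_smul {f : F → V} (hf : Integrable f μ) (w : W) :
    Integrable (fun t => Real.fourierChar (-(L t w)) • f t) μ := by
  refine hf.norm.mono'
    ((continuous_char L w).aestronglyMeasurable.smul hf.aestronglyMeasurable)
    (ae_of_all _ fun t => ?_)
  rw [Circle.norm_smul]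

theorem hasFDerivAt_partialFourier (H : 𝓢(E × F, V)) (z : E × W) :
    HasFDerivAt (partialFourier L μ H) (partialFourier L μ (derivSymbol L H) z) z := by
  obtain ⟨B, hB, h⟩ := exists_integrable_bound μ (derivSymbol L H)
  have h1 : ∀ z : E × W,
      Integrable (fun t => Real.fourierChar (-(L t z.2)) • H (z.1, t)) μ := fun z =>
    integrable_char_smul L μ (integrable_slice μ H z.1) z.2
  have h2 : Integrable (fun t => Real.fourierChar (-(L t z.2)) • derivSymbol L H (z.1, t)) μ :=
    integrable_char_smul L μ (integrable_slice μ (derivSymbol L H) z.1) z.2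
  have h3 : ∀ t (y : E × W), ‖Real.fourierChar (-(L t y.2)) • derivSymbol L H (y.1, t)‖ ≤ B t :=
    fun t y => (Circle.norm_smul _ _).trans_le (h y.1 t)
  have h4 := hasFDerivAt_integral_of_dominated_of_fderiv_le (𝕜 := ℝ) (s := Set.univ) (bound := B)
    (x₀ := z) (F := fun z t => Real.fourierChar (-(L t z.2)) • H (z.1, t))
    (F' := fun z t => Real.fourierChar (-(L t z.2)) • derivSymbol L H (z.1, t))
    Filter.univ_mem (Filter.Eventually.of_forall fun z => (h1 z).aestronglyMeasurable)
    (h1 z) h2.aestronglyMeasurable (ae_of_all _ fun t y _ => h3 t y) hB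
    (ae_of_all _ fun t y _ => hasFDerivAt_char_smul L H t y)
  exact h4

theorem fderiv_partialFourier (H : 𝓢(E × F, V)) :
    fderiv ℝ (partialFourier L μ H : E × W → V) = partialFourier L μ (derivSymbol L H) :=
  funext fun z => (hasFDerivAt_partialFourier L μ H z).fderiv

/-- The derivative is the partial Fourier transform of a Schwartz function with values in a space of
linear maps. The induction on n therefore has to run over all target spaces V simultaneously. -/
theorem contDiff_partialFourier (n : ℕ) : ∀ {V : Type} [NormedAddCommGroup V] [NormedSpace ℝ V]
    [NormedSpace ℂ V] [IsScalarTower ℝ ℂ V] (H : 𝓢(E × F, V)),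
    ContDiff ℝ n (partialFourier L μ H : E × W → V) := by
  induction n with
  | zero =>
    intro V _ _ _ _ H
    exact contDiff_zero.2 (continuous_iff_continuousAt.2 fun z =>
      (hasFDerivAt_partialFourier L μ H z).continuousAt)
  | succ n ih =>
    intro V _ _ _ _ H
    rw [Nat.cast_succ, contDiff_succ_iff_fderiv]
    refine ⟨fun z => (hasFDerivAt_partialFourier L μ H z).differentiableAt, by simp, ?_⟩
    rw [fderiv_partialFourier]
    exact ih _

/-- Integration by parts. -/
theorem smul_partialFourier (H : 𝓢(E × F, V)) (c : F) (z : E × W) :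
    (2 * Real.pi * Complex.I * L c z.2 : ℂ) • partialFourier L μ H z =
      partialFourier L μ (LineDeriv.lineDerivOp ((0 : E), c) H) z := by
  have hc : ∀ t, HasFDerivAt (fun t => H (z.1, t))
      ((fderiv ℝ H (z.1, t)).comp (ContinuousLinearMap.inr ℝ E F)) t := fun t =>
    HasFDerivAt.comp (g := H) t (H.hasFDerivAt (z.1, t)) (hasFDerivAt_prodMk_right z.1 t)
  have hd : ∀ t, fderiv ℝ (fun t => H (z.1, t)) t c =
      LineDeriv.lineDerivOp ((0 : E), c) H (z.1, t) := fun t => by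
    rw [(hc t).fderiv, SchwartzMap.lineDerivOp_apply_eq_fderiv]; rfl
  have hg : ∀ t, fderiv ℝ (fun t => (Real.fourierChar (-(L t z.2)) : ℂ)) t c =
      -(2 * Real.pi * Complex.I * L c z.2) * Real.fourierChar (-(L t z.2)) := fun t => by
    rw [Real.fderiv_fourierChar_neg_bilinear_left_apply]; ring
  have h := integral_smul_fderiv_eq_neg_fderiv_smul_of_integrable (μ := μ) (v := c)
    (f := fun t => (Real.fourierChar (-(L t z.2)) : ℂ)) (g := fun t => H (z.1, t)) ?_ ?_ ?_
    (fun t _ => (Real.differentiable_fourierChar_neg_bilinear_left L z.2).differentiableAt)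
    (fun t _ => (hc t).differentiableAt)
  · simp only [hd, hg, mul_smul] at h
    rw [partialFourier, partialFourier, ← integral_smul]
    simp only [Circle.smul_def, ← mul_smul]
    simp only [← mul_smul, neg_mul, neg_smul, integral_neg, neg_neg] at h
    exact h.symm
  · simp only [hg, mul_smul]
    exact (integrable_char_smul L μ (integrable_slice μ H z.1) z.2).smul
      (-(2 * Real.pi * Complex.I * L c z.2) : ℂ)
  · simp only [hd]
    exact integrable_char_smul L μ (integrable_slice μ _ z.1) z.2
  · exact integrable_char_smul L μ (integrable_slice μ H z.1) z.2

end Decay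

end PartialFourier

/-! ### Moment bounds and their transport through the partial Fourier transform -/

namespace PartialFourier

variable {E F W V : Type} [NormedAddCommGroup E] [NormedSpace ℝ E]
  [NormedAddCommGroup F] [NormedSpace ℝ F] [NormedAddCommGroup W] [NormedSpace ℝ W]
  [NormedAddCommGroup V] [NormedSpace ℝ V]
  (L : F →L[ℝ] W →L[ℝ] ℝ)

/-- The bounds `|x|^k |D^n f(x)| ≤ A M_{k+n+m}`. -/
def MomentBound (M : ℕ → ℝ) (A : ℝ) (m : ℕ) (f : E → V) : Prop :=
  ∀ k n x, ‖x‖ ^ k * ‖iteratedFDeriv ℝ n f x‖ ≤ A * M (k + n + m)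

theorem norm_phase_le : ‖phase E L‖ ≤ ‖L‖ := by
  refine ContinuousLinearMap.opNorm_le_bound _ (norm_nonneg L) fun p => ?_
  refine ContinuousLinearMap.opNorm_le_bound _ (by positivity) fun z => ?_
  rw [phase_apply]
  refine (L.le_opNorm₂ p.2 z.2).trans ?_
  gcongr
  · exact norm_snd_le p
  · exact norm_snd_le z

theorem iteratedFDeriv_clm_add_two (T : E →L[ℝ] V) (k : ℕ) :
    iteratedFDeriv ℝ (k + 1 + 1) T = 0 := by
  ext x : 1
  have h : ‖iteratedFDeriv ℝ (k + 1 + 1) T x‖ = 0 := by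
    rw [← norm_iteratedFDeriv_fderiv]
    have : fderiv ℝ T = fun _ => T := funext fun x => T.fderiv
    rw [this, iteratedFDeriv_succ_const]
    simp
  exact norm_eq_zero.1 h

/-- The phase is linear, so in Leibniz's formula only the terms with zero or one derivative on it
survive. -/
theorem norm_iteratedFDeriv_phase_smulRight_le {H : E × F → V} (hH : ContDiff ℝ ∞ H) (n : ℕ)
    (p : E × F) :
    ‖iteratedFDeriv ℝ n (fun p => (phase E L p).smulRight (H p)) p‖ ≤
      ‖L‖ * (‖p‖ * ‖iteratedFDeriv ℝ n H p‖ + n * ‖iteratedFDeriv ℝ (n - 1) H p‖) := by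
  have h := ContinuousLinearMap.norm_iteratedFDeriv_le_of_bilinear_of_le_one
    (ContinuousLinearMap.smulRightL ℝ (E × W) V) (phase E L).contDiff hH p
    (n := n) (mod_cast le_top) ContinuousLinearMap.norm_smulRightL_le
  refine h.trans ?_
  have h0 : ‖phase E L p‖ ≤ ‖L‖ * ‖p‖ :=
    ((phase E L).le_opNorm p).trans (by gcongr; exact norm_phase_le L)
  have h1 : ‖iteratedFDeriv ℝ 1 (phase E L) p‖ ≤ ‖L‖ := by
    rw [← norm_iteratedFDeriv_fderiv, norm_iteratedFDeriv_zero, ContinuousLinearMap.fderiv]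
    exact norm_phase_le L
  rcases n with _ | n
  · simp only [zero_add, Finset.sum_range_one, Nat.choose_self, Nat.cast_one, one_mul,
      norm_iteratedFDeriv_zero, Nat.cast_zero, Nat.sub_zero, zero_mul, add_zero]
    rw [← mul_assoc]
    exact mul_le_mul_of_nonneg_right h0 (norm_nonneg _)
  · rw [Finset.sum_range_succ', Finset.sum_range_succ', Finset.sum_eq_zero]
    · simp only [zero_add, Nat.choose_one_right, Nat.choose_zero_right, Nat.cast_one, one_mul,
        norm_iteratedFDeriv_zero, Nat.sub_zero]
      calc _ ≤ (n + 1 : ℕ) * ‖L‖ * ‖iteratedFDeriv ℝ (n + 1 - 1) H p‖ +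
            ‖L‖ * ‖p‖ * ‖iteratedFDeriv ℝ (n + 1) H p‖ := by gcongr
        _ = _ := by ring
    · intro i _
      rw [iteratedFDeriv_clm_add_two]
      simp

theorem contDiff_clm_fderiv {U : Type} [NormedAddCommGroup U] [NormedSpace ℝ U] {H : E → V}
    (hH : ContDiff ℝ ∞ H) (T : (E →L[ℝ] V) →L[ℝ] U) :
    ContDiff ℝ ∞ (fun p => T (fderiv ℝ H p)) :=
  T.contDiff.comp (hH.fderiv_right (m := ∞) (by simp))

theorem norm_iteratedFDeriv_clm_fderiv_le {U : Type} [NormedAddCommGroup U] [NormedSpace ℝ U]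
    {H : E → V} (hH : ContDiff ℝ ∞ H) {T : (E →L[ℝ] V) →L[ℝ] U} (hT : ‖T‖ ≤ 1) (n : ℕ) (p : E) :
    ‖iteratedFDeriv ℝ n (fun p => T (fderiv ℝ H p)) p‖ ≤ ‖iteratedFDeriv ℝ (n + 1) H p‖ := by
  refine (T.norm_iteratedFDeriv_comp_left
    ((hH.fderiv_right (m := ∞) (by simp)).contDiffAt) (mod_cast le_top)).trans ?_
  rw [norm_iteratedFDeriv_fderiv]
  exact mul_le_of_le_one_left (norm_nonneg _) hT

theorem norm_precomp_baseIncl_le :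
    ‖(ContinuousLinearMap.precomp V (baseIncl E F W) :
      ((E × F) →L[ℝ] V) →L[ℝ] ((E × W) →L[ℝ] V))‖ ≤ 1 := by
  refine ContinuousLinearMap.opNorm_le_bound _ zero_le_one fun T => ?_
  rw [one_mul]
  exact (ContinuousLinearMap.opNorm_comp_le T (baseIncl E F W)).trans
    (mul_le_of_le_one_right (norm_nonneg _) norm_baseIncl_le)

theorem contDiff_phase_smulRight {H : E × F → V} (hH : ContDiff ℝ ∞ H) :
    ContDiff ℝ ∞ (fun p => (phase E L p).smulRight (H p)) :=
  (ContinuousLinearMap.smulRightL ℝ (E × W) V).isBoundedBilinearMap.contDiff.comp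
    ((phase E L).contDiff.prodMk hH)

theorem norm_iteratedFDeriv_add_const_smul_le {f g : E → V} [NormedSpace ℂ V]
    [IsScalarTower ℝ ℂ V] (hf : ContDiff ℝ ∞ f) (hg : ContDiff ℝ ∞ g) (c : ℂ) (n : ℕ) (p : E) :
    ‖iteratedFDeriv ℝ n (f + c • g) p‖ ≤
      ‖iteratedFDeriv ℝ n f p‖ + ‖c‖ * ‖iteratedFDeriv ℝ n g p‖ := by
  have h : ContDiff ℝ ∞ (c • g) := hg.const_smul c
  rw [iteratedFDeriv_add_apply (hf.contDiffAt.of_le (mod_cast le_top))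
    (h.contDiffAt.of_le (mod_cast le_top)),
    iteratedFDeriv_const_smul_apply (hg.contDiffAt.of_le (mod_cast le_top)), ← norm_smul]
  exact norm_add_le _ _

theorem coe_derivSymbol [NormedSpace ℂ V] [IsScalarTower ℝ ℂ V]
    (H : 𝓢(E × F, V)) : ⇑(derivSymbol L H) =
      (fun p => ContinuousLinearMap.precomp V (baseIncl E F W) (fderiv ℝ H p)) +
      (-(2 * Real.pi * Complex.I) : ℂ) • fun p => (phase E L p).smulRight (H p) := rfl

theorem norm_iteratedFDeriv_derivSymbol_le [NormedSpace ℂ V] [IsScalarTower ℝ ℂ V]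
    (H : 𝓢(E × F, V)) (n : ℕ) (p : E × F) :
    ‖iteratedFDeriv ℝ n (PartialFourier.derivSymbol L H) p‖ ≤
      ‖iteratedFDeriv ℝ (n + 1) H p‖ + 2 * Real.pi *
        (‖L‖ * (‖p‖ * ‖iteratedFDeriv ℝ n H p‖ + n * ‖iteratedFDeriv ℝ (n - 1) H p‖)) := by
  have hH : ContDiff ℝ ∞ H := H.smooth'
  have a3 : ‖(-(2 * Real.pi * Complex.I) : ℂ)‖ = 2 * Real.pi := by
    simp [abs_of_pos Real.pi_pos]
  have h := norm_iteratedFDeriv_add_const_smul_le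
    (contDiff_clm_fderiv hH (ContinuousLinearMap.precomp V (baseIncl E F W)))
    (contDiff_phase_smulRight L hH) (-(2 * Real.pi * Complex.I) : ℂ) n p
  rw [a3] at h
  rw [coe_derivSymbol]
  have h1 := norm_iteratedFDeriv_clm_fderiv_le hH
    (T := ContinuousLinearMap.precomp V (baseIncl E F W)) norm_precomp_baseIncl_le n p
  have h2 := norm_iteratedFDeriv_phase_smulRight_le L (W := W) hH n p
  generalize ‖iteratedFDeriv ℝ n (fun p => (phase E L p).smulRight (H p)) p‖ = b at h h2
  have h3 := mul_le_mul_of_nonneg_left h2 (by positivity : 0 ≤ 2 * Real.pi)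
  exact h.trans (add_le_add h1 h3)

/-- The shift m counts the operations already performed. An extra derivative or an extra moment
raises the index by one. The Leibniz term n D^{n-1}H lowers the order by one, and its factor n is
paid for by two index steps through `hM`, so it too ends one above the start. The three terms give
the constant 1 + 2π‖L‖ · 2. -/
theorem MomentBound.derivSymbol [NormedSpace ℂ V] [IsScalarTower ℝ ℂ V] {M : ℕ → ℝ}
    (hM : ∀ N : ℕ, (N + 1) * M N ≤ M (N + 2)) {A : ℝ} (hA : 0 ≤ A) {m : ℕ} {H : 𝓢(E × F, V)}
    (h : MomentBound M A m H) :
    MomentBound M ((1 + 4 * Real.pi * ‖L‖) * A) (m + 1) (PartialFourier.derivSymbol L H) := by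
  intro k n p
  have k1 : ‖p‖ ^ k * ‖iteratedFDeriv ℝ (n + 1) H p‖ ≤ A * M (k + n + (m + 1)) := by
    have := h k (n + 1) p
    rwa [show k + (n + 1) + m = k + n + (m + 1) by ring] at this
  have k2 : ‖p‖ ^ k * (‖p‖ * ‖iteratedFDeriv ℝ n H p‖) ≤ A * M (k + n + (m + 1)) := by
    have := h (k + 1) n p
    rwa [show k + 1 + n + m = k + n + (m + 1) by ring, pow_succ, mul_assoc] at this
  have k3 : ‖p‖ ^ k * (n * ‖iteratedFDeriv ℝ (n - 1) H p‖) ≤ A * M (k + n + (m + 1)) := by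
    -- For n = 0 the factor n annihilates the term with the truncated order n - 1.
    rcases n with _ | n
    · simpa using (by positivity : (0 : ℝ) ≤ _).trans k1
    · have h1 := h k n p
      have h2 := hM (k + n + m)
      have h4 : 0 ≤ A * M (k + n + m) := le_trans (by positivity) h1
      rw [show k + n + m + 2 = k + (n + 1) + (m + 1) by ring] at h2
      calc ‖p‖ ^ k * ((n + 1 : ℕ) * ‖iteratedFDeriv ℝ (n + 1 - 1) H p‖)
          = (n + 1 : ℕ) * (‖p‖ ^ k * ‖iteratedFDeriv ℝ n H p‖) := by
            rw [Nat.add_sub_cancel]; ring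
        _ ≤ (n + 1 : ℕ) * (A * M (k + n + m)) := by gcongr
        _ ≤ ((k + n + m : ℕ) + 1) * (A * M (k + n + m)) := by
            refine mul_le_mul_of_nonneg_right ?_ h4
            push_cast
            linarith [(Nat.cast_nonneg k : (0 : ℝ) ≤ k), (Nat.cast_nonneg m : (0 : ℝ) ≤ m)]
        _ = A * (((k + n + m : ℕ) + 1) * M (k + n + m)) := by ring
        _ ≤ _ := by gcongr
  calc ‖p‖ ^ k * ‖iteratedFDeriv ℝ n (PartialFourier.derivSymbol L H) p‖
      ≤ ‖p‖ ^ k * (‖iteratedFDeriv ℝ (n + 1) H p‖ + 2 * Real.pi *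
        (‖L‖ * (‖p‖ * ‖iteratedFDeriv ℝ n H p‖ + n * ‖iteratedFDeriv ℝ (n - 1) H p‖))) := by
        gcongr
        exact norm_iteratedFDeriv_derivSymbol_le L H n p
    _ = ‖p‖ ^ k * ‖iteratedFDeriv ℝ (n + 1) H p‖ + 2 * Real.pi * ‖L‖ *
        (‖p‖ ^ k * (‖p‖ * ‖iteratedFDeriv ℝ n H p‖) +
          ‖p‖ ^ k * (n * ‖iteratedFDeriv ℝ (n - 1) H p‖)) := by ring
    _ ≤ A * M (k + n + (m + 1)) + 2 * Real.pi * ‖L‖ *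
        (A * M (k + n + (m + 1)) + A * M (k + n + (m + 1))) := by gcongr
    _ = _ := by ring

theorem MomentBound.lineDeriv {M : ℕ → ℝ} {A : ℝ} {m : ℕ} {H : 𝓢(E, V)}
    (h : MomentBound M A m H) {v : E} (hv : ‖v‖ ≤ 1) :
    MomentBound M A (m + 1) (LineDeriv.lineDerivOp v H : 𝓢(E, V)) := by
  intro k n p
  have hH : ContDiff ℝ ∞ H := H.smooth'
  have := h k (n + 1) p
  rw [show k + (n + 1) + m = k + n + (m + 1) by ring] at this
  refine le_trans (mul_le_mul_of_nonneg_left ?_ (by positivity)) this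
  refine norm_iteratedFDeriv_clm_fderiv_le hH (T := ContinuousLinearMap.apply ℝ V v) ?_ n p
  refine ContinuousLinearMap.opNorm_le_bound _ zero_le_one fun T => ?_
  rw [one_mul]
  exact (T.le_opNorm v).trans (mul_le_of_le_one_right (norm_nonneg _) hv)

section Decay

variable [NormedSpace ℂ V] [IsScalarTower ℝ ℂ V] [FiniteDimensional ℝ F] [MeasurableSpace F]
  [BorelSpace F] (μ : Measure F) [μ.IsAddHaarMeasure]

/-- The constant in the bound of an integral by suprema. -/
def integralConst : ℝ :=
  2 ^ μ.integrablePower * ∫ t, (1 + ‖t‖) ^ (-(μ.integrablePower : ℝ)) ∂μ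

theorem integralConst_nonneg : 0 ≤ integralConst μ :=
  mul_nonneg (by positivity) (integral_nonneg fun t => by positivity)

/-- A weight in the base variable passes under the integral sign. The L¹ norm in t is then
controlled by two suprema, one without weight in t and one with weight of order `μ.integrablePower`.
-/
theorem pow_norm_fst_mul_partialFourier_le {M : ℕ → ℝ} {A : ℝ} {m : ℕ} {H : 𝓢(E × F, V)}
    (h : MomentBound M A m H) (k : ℕ) (z : E × W) :
    ‖z.1‖ ^ k * ‖partialFourier L μ H z‖ ≤
      integralConst μ * (A * M (k + m) + A * M (k + μ.integrablePower + m)) := by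
  have h1 : ‖partialFourier L μ H z‖ ≤ ∫ t, ‖H (z.1, t)‖ ∂μ := by
    refine (norm_integral_le_integral_norm _).trans (le_of_eq ?_)
    simp_rw [Circle.norm_smul]
  have h2 := integral_pow_mul_le_of_le_of_pow_mul_le (μ := μ) (k := 0)
    (f := fun t => ‖z.1‖ ^ k • H (z.1, t)) (C₁ := A * M (k + m))
    (C₂ := A * M (k + μ.integrablePower + m)) ?_ ?_
  · calc ‖z.1‖ ^ k * ‖partialFourier L μ H z‖ ≤ ‖z.1‖ ^ k * ∫ t, ‖H (z.1, t)‖ ∂μ := by gcongr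
      _ = ∫ t, ‖t‖ ^ 0 * ‖‖z.1‖ ^ k • H (z.1, t)‖ ∂μ := by
        rw [← integral_const_mul]
        simp [norm_smul]
      _ ≤ _ := h2
  · intro t
    refine le_trans ?_ (h k 0 (z.1, t))
    rw [norm_smul, norm_iteratedFDeriv_zero, norm_pow, norm_norm]
    gcongr
    exact norm_fst_le (z.1, t)
  · intro t
    refine le_trans ?_ (h (k + μ.integrablePower) 0 (z.1, t))
    rw [norm_smul, norm_iteratedFDeriv_zero, norm_pow, norm_norm, zero_add, ← mul_assoc, pow_add,
      mul_comm (‖t‖ ^ _)]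
    gcongr
    · exact norm_fst_le (z.1, t)
    · exact norm_snd_le (z.1, t)

/-- Each power of L(c, w) is exchanged for a derivative of H along (0, c) by integration by parts.
This raises m by one and leaves A unchanged because ‖c‖ ≤ 1; the factor 2π ≥ 1 is discarded. -/
theorem pow_pairing_mul_partialFourier_le {M : ℕ → ℝ} {A : ℝ} {c : F} (hc : ‖c‖ ≤ 1) (z : E × W)
    (k : ℕ) : ∀ {m : ℕ} {H : 𝓢(E × F, V)} (_ : MomentBound M A m H),
    |L c z.2| ^ k * ‖partialFourier L μ H z‖ ≤
      integralConst μ * (A * M (k + m) + A * M (k + μ.integrablePower + m)) := by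
  induction k with
  | zero =>
    intro m H h
    simpa using pow_norm_fst_mul_partialFourier_le L μ h 0 z
  | succ k ih =>
    intro m H h
    have hv : ‖((0 : E), c)‖ ≤ 1 := by simpa [Prod.norm_def] using hc
    have h1 := ih (h.lineDeriv hv)
    rw [← smul_partialFourier, norm_smul] at h1
    have h2 : |L c z.2| ≤ ‖(2 * Real.pi * Complex.I * L c z.2 : ℂ)‖ := by
      simp only [norm_mul, Complex.norm_I, Complex.norm_real, Real.norm_eq_abs, Complex.norm_ofNat,
        abs_of_pos Real.pi_pos, mul_one]
      exact le_mul_of_one_le_left (abs_nonneg _) (by linarith [Real.pi_gt_three])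
    rw [show k + 1 + m = k + (m + 1) by ring,
      show k + 1 + μ.integrablePower + m = k + μ.integrablePower + (m + 1) by ring]
    refine le_trans ?_ h1
    rw [pow_succ, mul_assoc]
    gcongr

/-- The norm of a pair is the maximum, so a power of it is a power of one component, and each
component has its own estimate. The direction c may depend on w, since the estimate along c is
uniform over the unit ball. -/
theorem pow_norm_mul_partialFourier_le {D : ℝ} (hD : 1 ≤ D)
    (hL : ∀ w : W, ∃ c : F, ‖c‖ ≤ 1 ∧ ‖w‖ ≤ D * |L c w|)
    {M : ℕ → ℝ} {A : ℝ} {m : ℕ} {H : 𝓢(E × F, V)}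
    (h : MomentBound M A m H) (k : ℕ) (z : E × W) :
    ‖z‖ ^ k * ‖partialFourier L μ H z‖ ≤
      D ^ k * (integralConst μ * (A * M (k + m) + A * M (k + μ.integrablePower + m))) := by
  have h1 := pow_norm_fst_mul_partialFourier_le L μ h k z
  obtain ⟨c, hc, hw⟩ := hL z.2
  rcases max_choice ‖z.1‖ ‖z.2‖ with e | e
  · rw [Prod.norm_def, e]
    exact h1.trans (le_mul_of_one_le_left (le_trans (by positivity) h1) (one_le_pow₀ hD))
  · rw [Prod.norm_def, e]
    have h2 := pow_pairing_mul_partialFourier_le L μ hc z k h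
    calc ‖z.2‖ ^ k * ‖partialFourier L μ H z‖
        ≤ (D * |L c z.2|) ^ k * ‖partialFourier L μ H z‖ := by gcongr
      _ = D ^ k * (|L c z.2| ^ k * ‖partialFourier L μ H z‖) := by rw [mul_pow]; ring
      _ ≤ _ := by gcongr

theorem pow_norm_mul_iteratedFDeriv_partialFourier_le {D : ℝ} (hD : 1 ≤ D)
    (hL : ∀ w : W, ∃ c : F, ‖c‖ ≤ 1 ∧ ‖w‖ ≤ D * |L c w|)
    {M : ℕ → ℝ} (hM : ∀ N : ℕ, (N + 1) * M N ≤ M (N + 2)) (k n : ℕ) (z : E × W) :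
    ∀ {V : Type} [NormedAddCommGroup V] [NormedSpace ℝ V] [NormedSpace ℂ V] [IsScalarTower ℝ ℂ V]
      {A : ℝ} (_ : 0 ≤ A) {m : ℕ} {H : 𝓢(E × F, V)} (_ : MomentBound M A m H),
    ‖z‖ ^ k * ‖iteratedFDeriv ℝ n (partialFourier L μ H) z‖ ≤
      (1 + 4 * Real.pi * ‖L‖) ^ n * D ^ k * (integralConst μ *
        (A * M (k + n + m) + A * M (k + n + μ.integrablePower + m))) := by
  induction n with
  | zero =>
    intro V _ _ _ _ A hA m H h
    simpa using pow_norm_mul_partialFourier_le L μ hD hL h k z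
  | succ n ih =>
    intro V _ _ _ _ A hA m H h
    rw [← norm_iteratedFDeriv_fderiv, fderiv_partialFourier]
    refine (ih (by positivity) (h.derivSymbol (W := W) L hM hA)).trans (le_of_eq ?_)
    rw [show k + (n + 1) + m = k + n + (m + 1) by ring,
      show k + (n + 1) + μ.integrablePower + m = k + n + μ.integrablePower + (m + 1) by ring]
    ring

end Decay

end PartialFourier

/-! ### Gelfand-Shilov bounds under linear substitutions and products -/

theorem Nat.factorial_add_le_two_pow_mul (a b : ℕ) : (a + b)! ≤ 2 ^ (a + b) * (a ! * b !) := by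
  rw [← Nat.add_choose_mul_factorial_mul_factorial, mul_assoc]
  exact Nat.mul_le_mul_right _ (Nat.choose_le_two_pow _ _)

namespace GelfandShilov

variable {E F X : Type} [NormedAddCommGroup E] [NormedSpace ℝ E]
  [NormedAddCommGroup F] [NormedSpace ℝ F] [NormedAddCommGroup X] [NormedSpace ℝ X]

/-- The bounds `|x|^k |D^n f(x)| ≤ A h^(k+n) k! n!`. -/
def Bound (h A : ℝ) (f : E → ℂ) : Prop :=
  ∀ (k n : ℕ) (x : E), ‖x‖ ^ k * ‖iteratedFDeriv ℝ n f x‖ ≤ A * (h ^ (k + n) * k ! * n !)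

theorem exists_bound (f : GelfandShilov E) {h : ℝ} (hh : 0 < h) : ∃ A, 0 ≤ A ∧ Bound h A f := by
  obtain ⟨A, hA⟩ := f.2.2 h hh
  refine ⟨A, ?_, hA⟩
  simpa using (by positivity : (0 : ℝ) ≤ _).trans (hA 0 0 0)

theorem bound_hNorm (h : {h : ℝ // 0 < h}) (f : GelfandShilov E) : Bound h.1 (hNorm h f) f := by
  intro k n x
  have hh := h.2
  rw [← div_le_iff₀ (by positivity)]
  exact le_ciSup (quotient_bddAbove h.2 f) (k, n, x)

theorem hNorm_le {h : {h : ℝ // 0 < h}} {f : GelfandShilov E} {A : ℝ} (hA : Bound h.1 A f) :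
    hNorm h f ≤ A := by
  refine ciSup_le fun z => ?_
  have hh := h.2
  rw [quotient, div_le_iff₀ (by positivity)]
  exact hA _ _ _

theorem Bound.anti {h h' A : ℝ} (hh' : 0 ≤ h') (hle : h' ≤ h) (hA : 0 ≤ A) {f : E → ℂ}
    (hf : Bound h' A f) : Bound h A f := fun k n x =>
  (hf k n x).trans (by gcongr)

theorem Bound.conjugate {h A : ℝ} {f : GelfandShilov E} (hf : Bound h A f) :
    Bound h A f.conjugate := by
  intro k n x
  have := Complex.conjLIE.norm_iteratedFDeriv_comp_left (𝕜 := ℝ) (f : E → ℂ) x n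
  have e : (Complex.conjLIE ∘ (f : E → ℂ)) = f.conjugate := rfl
  rw [e] at this
  rw [this]
  exact hf k n x

/-- The inclusion of `S^{(1)}` in the Schwartz space. -/
def toSchwartz (f : GelfandShilov E) : 𝓢(E, ℂ) where
  toFun := f
  smooth' := f.contDiff
  decay' k n := by
    obtain ⟨C, hC⟩ := f.2.2 1 one_pos
    exact ⟨_, hC k n⟩

/-- A test function from a smooth function with bounds. -/
def ofBound (f : E → ℂ) (hf : ContDiff ℝ ∞ f) (h : ∀ h, 0 < h → ∃ A, Bound h A f) :
    GelfandShilov E := ⟨f, hf, h⟩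

theorem norm_iteratedFDeriv_comp_clm_le {f : E → ℂ} (hf : ContDiff ℝ ∞ f) (P : X →L[ℝ] E) {K : ℝ}
    (hP : ‖P‖ ≤ K) (n : ℕ) (x : X) :
    ‖iteratedFDeriv ℝ n (fun x => f (P x)) x‖ ≤ K ^ n * ‖iteratedFDeriv ℝ n f (P x)‖ := by
  have h := P.iteratedFDeriv_comp_right hf x (i := n) (mod_cast le_top)
  have e : f ∘ P = fun x => f (P x) := rfl
  rw [e] at h
  rw [h]
  refine (ContinuousMultilinearMap.norm_compContinuousLinearMap_le _ _).trans ?_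
  rw [mul_comm, Finset.prod_const, Finset.card_univ, Fintype.card_fin]
  gcongr

section Comp

theorem Bound.comp_clm {f : E → ℂ} (hf : ContDiff ℝ ∞ f) {P : X →L[ℝ] E} {K : ℝ} (hK : 1 ≤ K)
    (hP : ‖P‖ ≤ K) (hPK : ∀ x, ‖x‖ ≤ K * ‖P x‖) {h A : ℝ} (h' : Bound (h / K) A f) :
    Bound h A (fun x => f (P x)) := by
  intro k n x
  calc ‖x‖ ^ k * ‖iteratedFDeriv ℝ n (fun x => f (P x)) x‖
      ≤ (K * ‖P x‖) ^ k * (K ^ n * ‖iteratedFDeriv ℝ n f (P x)‖) := by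
        gcongr
        · exact hPK x
        · exact norm_iteratedFDeriv_comp_clm_le hf P hP n x
    _ = K ^ (k + n) * (‖P x‖ ^ k * ‖iteratedFDeriv ℝ n f (P x)‖) := by ring
    _ ≤ K ^ (k + n) * (A * ((h / K) ^ (k + n) * k ! * n !)) := by
        exact mul_le_mul_of_nonneg_left (h' k n (P x)) (by positivity)
    _ = _ := by
        rw [div_pow]
        field_simp

/-- The composition of a test function with a linear embedding. -/
def compCLM (f : GelfandShilov E) (P : X →L[ℝ] E) {K : ℝ} (hK : 1 ≤ K)
    (hP : ‖P‖ ≤ K) (hPK : ∀ x, ‖x‖ ≤ K * ‖P x‖) : GelfandShilov X :=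
  ofBound (fun x => f (P x)) (f.contDiff.comp P.contDiff) fun h hh => by
    obtain ⟨A, -, hA⟩ := f.exists_bound (h := h / K) (by positivity)
    exact ⟨A, hA.comp_clm f.contDiff hK hP hPK⟩

end Comp

section MulComp

theorem sum_choose_mul_factorial (n : ℕ) :
    ∑ i ∈ Finset.range (n + 1), ((n.choose i * i ! * (n - i)! : ℕ) : ℝ) ≤ 2 ^ n * n ! := by
  have : ∀ i ∈ Finset.range (n + 1), ((n.choose i * i ! * (n - i)! : ℕ) : ℝ) = n ! :=
    fun i hi => by
      rw [Nat.choose_mul_factorial_mul_factorial (Nat.lt_succ_iff.1 (Finset.mem_range.1 hi))]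
  rw [Finset.sum_congr rfl this, Finset.sum_const, Finset.card_range, nsmul_eq_mul]
  gcongr
  exact_mod_cast Nat.lt_two_pow_self (n := n)

/-- The whole weight is placed on the factor whose argument is larger. In Leibniz's formula each
binomial coefficient times its two factorials is n!, so the sum costs n + 1 ≤ 2^n. With K^(k+n) from
the linear maps, the total loss is (2K)^(k+n), which explains h/(2K). -/
theorem Bound.mul_comp {f : E → ℂ} {g : F → ℂ} (hf : ContDiff ℝ ∞ f) (hg : ContDiff ℝ ∞ g)
    {P : X →L[ℝ] E} {Q : X →L[ℝ] F} {K : ℝ} (hK : 1 ≤ K)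
    (hP : ‖P‖ ≤ K) (hQ : ‖Q‖ ≤ K) (hPQ : ∀ x, ‖x‖ ≤ K * max ‖P x‖ ‖Q x‖) {h A B : ℝ}
    (hh : 0 < h) (hA : 0 ≤ A) (hB : 0 ≤ B)
    (h₁ : Bound (h / (2 * K)) A f) (h₂ : Bound (h / (2 * K)) B g) :
    Bound h (A * B) (fun x => f (P x) * g (Q x)) := by
  intro k n x
  have hd := norm_iteratedFDeriv_mul_le (𝕜 := ℝ) (f := fun x => f (P x)) (g := fun x => g (Q x))
    (hf.comp P.contDiff) (hg.comp Q.contDiff) x (n := n) (mod_cast le_top)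
  set t := h / (2 * K) with ht
  have ht0 : 0 < t := by positivity
  have key : ∀ i ∈ Finset.range (n + 1),
      max ‖P x‖ ‖Q x‖ ^ k * (‖iteratedFDeriv ℝ i f (P x)‖ * ‖iteratedFDeriv ℝ (n - i) g (Q x)‖) ≤
        A * B * (t ^ (k + n) * k ! * (i ! * (n - i)!)) := by
    intro i hi
    have hin : i + (n - i) = n := Nat.add_sub_cancel' (Nat.lt_succ_iff.1 (Finset.mem_range.1 hi))
    have e : t ^ (k + n) = t ^ k * t ^ i * t ^ (n - i) := by
      rw [← pow_add, ← pow_add, add_assoc, hin]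
    have f0 := h₁ 0 i (P x)
    have g0 := h₂ 0 (n - i) (Q x)
    have fk := h₁ k i (P x)
    have gk := h₂ k (n - i) (Q x)
    simp only [pow_zero, one_mul, zero_add, Nat.factorial_zero, Nat.cast_one, mul_one] at f0 g0
    rcases max_choice ‖P x‖ ‖Q x‖ with m | m <;> rw [m]
    · calc _ = (‖P x‖ ^ k * ‖iteratedFDeriv ℝ i f (P x)‖) *
            ‖iteratedFDeriv ℝ (n - i) g (Q x)‖ := by ring
        _ ≤ (A * (t ^ (k + i) * k ! * i !)) * (B * (t ^ (n - i) * (n - i)!)) := by gcongr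
        _ = _ := by rw [e]; ring
    · calc _ = ‖iteratedFDeriv ℝ i f (P x)‖ *
            (‖Q x‖ ^ k * ‖iteratedFDeriv ℝ (n - i) g (Q x)‖) := by ring
        _ ≤ (A * (t ^ i * i !)) * (B * (t ^ (k + (n - i)) * k ! * (n - i)!)) := by gcongr
        _ = _ := by rw [e]; ring
  calc ‖x‖ ^ k * ‖iteratedFDeriv ℝ n (fun x => f (P x) * g (Q x)) x‖
      ≤ (K * max ‖P x‖ ‖Q x‖) ^ k * ∑ i ∈ Finset.range (n + 1), (n.choose i : ℝ) *
        (K ^ i * ‖iteratedFDeriv ℝ i f (P x)‖) *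
          (K ^ (n - i) * ‖iteratedFDeriv ℝ (n - i) g (Q x)‖) := by
        gcongr
        · exact hPQ x
        · refine hd.trans (Finset.sum_le_sum fun i _ => ?_)
          gcongr
          · exact norm_iteratedFDeriv_comp_clm_le hf P hP i x
          · exact norm_iteratedFDeriv_comp_clm_le hg Q hQ (n - i) x
    _ = ∑ i ∈ Finset.range (n + 1), K ^ (k + n) * n.choose i * (max ‖P x‖ ‖Q x‖ ^ k *
          (‖iteratedFDeriv ℝ i f (P x)‖ * ‖iteratedFDeriv ℝ (n - i) g (Q x)‖)) := by
        rw [Finset.mul_sum]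
        refine Finset.sum_congr rfl fun i hi => ?_
        have hin : i + (n - i) = n :=
          Nat.add_sub_cancel' (Nat.lt_succ_iff.1 (Finset.mem_range.1 hi))
        have e : K ^ (k + n) = K ^ k * K ^ i * K ^ (n - i) := by
          rw [← pow_add, ← pow_add, add_assoc, hin]
        rw [e]; ring
    _ ≤ ∑ i ∈ Finset.range (n + 1), K ^ (k + n) * n.choose i *
          (A * B * (t ^ (k + n) * k ! * (i ! * (n - i)!))) := by
        refine Finset.sum_le_sum fun i hi => ?_
        exact mul_le_mul_of_nonneg_left (key i hi) (by positivity)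
    _ = A * B * ((K * t) ^ (k + n) * k !) *
          ∑ i ∈ Finset.range (n + 1), ((n.choose i * i ! * (n - i)! : ℕ) : ℝ) := by
        rw [Finset.mul_sum]
        refine Finset.sum_congr rfl fun i hi => ?_
        push_cast
        ring
    _ ≤ A * B * ((K * t) ^ (k + n) * k !) * (2 ^ n * n !) := by
        gcongr
        exact sum_choose_mul_factorial n
    _ ≤ A * B * ((K * t) ^ (k + n) * k !) * (2 ^ (k + n) * n !) := by
        gcongr
        · norm_num
        · omega
    _ = A * B * ((2 * K * t) ^ (k + n) * k ! * n !) := by simp only [mul_pow]; ring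
    _ = _ := by rw [ht, mul_div_cancel₀ _ (by positivity)]

/-- The test function `x ↦ f (P x) g (Q x)` for linear maps `P, Q` that are jointly an
embedding. -/
def mulComp (f : GelfandShilov E) (g : GelfandShilov F) (P : X →L[ℝ] E) (Q : X →L[ℝ] F) {K : ℝ}
    (hK : 1 ≤ K) (hP : ‖P‖ ≤ K) (hQ : ‖Q‖ ≤ K) (hPQ : ∀ x, ‖x‖ ≤ K * max ‖P x‖ ‖Q x‖) :
    GelfandShilov X :=
  ofBound (fun x => f (P x) * g (Q x))
    ((f.contDiff.comp P.contDiff).mul (g.contDiff.comp Q.contDiff)) fun h hh => by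
      obtain ⟨A, hA, hA'⟩ := f.exists_bound (h := h / (2 * K)) (by positivity)
      obtain ⟨B, hB, hB'⟩ := g.exists_bound (h := h / (2 * K)) (by positivity)
      exact ⟨A * B, hA'.mul_comp f.contDiff g.contDiff hK hP hQ hPQ hh hA hB hB'⟩

end MulComp

/-! ### The partial Fourier transform on S^{(1)} -/

section Fourier

open PartialFourier

variable {W : Type} [NormedAddCommGroup W] [NormedSpace ℝ W] (L : F →L[ℝ] W →L[ℝ] ℝ)
  [FiniteDimensional ℝ F] [MeasurableSpace F] [BorelSpace F] (μ : Measure F) [μ.IsAddHaarMeasure]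

/-- The bounds t^(k+n) k! n! are replaced by the sequence M_N = t^N (N+c)!, which dominates them
since k! n! ≤ (k+n+c)!. After the moment estimate, the factorial is split again at the price of
4^(k+n) and a constant depending only on c and the integrability exponent. -/
theorem exists_bound_partialFourier {D : ℝ} (hD : 1 ≤ D)
    (hL : ∀ w : W, ∃ c : F, ‖c‖ ≤ 1 ∧ ‖w‖ ≤ D * |L c w|) {h : ℝ} (hh : 0 < h) :
    ∃ h' : ℝ, 0 < h' ∧ ∃ C : ℝ, 0 ≤ C ∧ ∀ (H : 𝓢(E × F, ℂ)) (A : ℝ), 0 ≤ A →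
      Bound h' A H → Bound h (C * A) (partialFourier L μ H) := by
  set K : ℝ := max (1 + 4 * Real.pi * ‖L‖) D
  have hK : 1 ≤ K := hD.trans (le_max_right _ _)
  have hK1 : 1 + 4 * Real.pi * ‖L‖ ≤ K := le_max_left _ _
  have hK2 : D ≤ K := le_max_right _ _
  -- The losses are K^(k+n) from the transform and 4^(k+n) from splitting the factorial twice, so
  -- that 4Kt = h.
  set t : ℝ := h / (4 * K) with ht
  have ht0 : 0 < t := by positivity
  -- The shift c makes M_{N+2}/M_N = t²(N+c+2)(N+c+1) at least N + 1 even when t is small.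
  obtain ⟨c, hc⟩ := exists_nat_ge (1 / t ^ 2)
  have hc' : 1 ≤ t ^ 2 * c := by
    rw [div_le_iff₀ (by positivity)] at hc
    linarith
  set M : ℕ → ℝ := fun N => t ^ N * (N + c)! with hMdef
  have hM0 : ∀ N, 0 ≤ M N := fun N => by positivity
  have hM : ∀ N : ℕ, (N + 1) * M N ≤ M (N + 2) := by
    intro N
    have e : ((N + 2 + c)! : ℝ) = (N + c + 2) * ((N + c + 1) * (N + c)!) := by
      rw [show N + 2 + c = (N + c + 1) + 1 by ring, Nat.factorial_succ, Nat.factorial_succ]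
      push_cast; ring
    have h2 : ((N : ℝ) + 1) ≤ t ^ 2 * ((N + c + 2) * (N + c + 1)) := by
      have hN : (0 : ℝ) ≤ N := Nat.cast_nonneg _
      have hcc : (0 : ℝ) ≤ c := Nat.cast_nonneg _
      calc ((N : ℝ) + 1) ≤ N + c + 1 := by linarith
        _ ≤ (t ^ 2 * c) * (N + c + 1) := le_mul_of_one_le_left (by positivity) hc'
        _ ≤ (t ^ 2 * (N + c + 2)) * (N + c + 1) := by gcongr; linarith
        _ = _ := by ring
    calc ((N : ℝ) + 1) * M N ≤ (t ^ 2 * ((N + c + 2) * (N + c + 1))) * M N :=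
          mul_le_mul_of_nonneg_right h2 (hM0 N)
      _ = M (N + 2) := by simp only [hMdef, e]; ring
  have hMle : ∀ j k n : ℕ, M (k + n + j) ≤
      t ^ j * 2 ^ (j + c) * (j + c)! * ((4 * t) ^ (k + n) * (k ! * n !)) := by
    intro j k n
    have a1 : ((k + n + j + c)! : ℝ) ≤ 2 ^ (k + n + (j + c)) * ((k + n)! * (j + c)!) := by
      rw [add_assoc (k + n)]
      exact_mod_cast Nat.factorial_add_le_two_pow_mul (k + n) (j + c)
    have a2 : ((k + n)! : ℝ) ≤ 2 ^ (k + n) * (k ! * n !) := by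
      exact_mod_cast Nat.factorial_add_le_two_pow_mul k n
    calc M (k + n + j) ≤ t ^ (k + n + j) *
          (2 ^ (k + n + (j + c)) * ((2 ^ (k + n) * (k ! * n !)) * (j + c)!)) := by
          refine mul_le_mul_of_nonneg_left (a1.trans ?_) (by positivity)
          gcongr
      _ = _ := by
          rw [show (4 : ℝ) * t = 2 * 2 * t by ring]
          simp only [mul_pow, pow_add]
          ring
  set l := μ.integrablePower
  refine ⟨t, ht0, integralConst μ * (t ^ 0 * 2 ^ (0 + c) * (0 + c)! + t ^ l * 2 ^ (l + c) *
    (l + c)!), mul_nonneg (integralConst_nonneg μ) (by positivity), fun H A hA hH k n z => ?_⟩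
  have hHM : MomentBound M A 0 H := by
    intro k n x
    refine (hH k n x).trans (mul_le_mul_of_nonneg_left ?_ hA)
    have : k ! * n ! ≤ (k + n + c)! :=
      (Nat.le_of_dvd (Nat.factorial_pos _) (Nat.factorial_mul_factorial_dvd_factorial_add k n)).trans
        (Nat.factorial_le (by omega))
    rw [mul_assoc, add_zero]
    refine mul_le_mul_of_nonneg_left ?_ (by positivity)
    exact_mod_cast this
  have hI := integralConst_nonneg μ
  refine (pow_norm_mul_iteratedFDeriv_partialFourier_le L μ hD hL hM k n z hA hHM).trans ?_
  have b0 := hMle 0 k n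
  have bl := hMle l k n
  calc _ ≤ K ^ n * K ^ k * (integralConst μ * (A *
        (t ^ 0 * 2 ^ (0 + c) * (0 + c)! * ((4 * t) ^ (k + n) * (k ! * n !))) + A *
        (t ^ l * 2 ^ (l + c) * (l + c)! * ((4 * t) ^ (k + n) * (k ! * n !))))) := by
        have := hM0 (k + n + 0)
        have := hM0 (k + n + l + 0)
        gcongr
        exact bl
    _ = integralConst μ * (t ^ 0 * 2 ^ (0 + c) * (0 + c)! + t ^ l * 2 ^ (l + c) *
        (l + c)!) * A * ((4 * K * t) ^ (k + n) * k ! * n !) := by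
        simp only [mul_pow, pow_add]
        ring
    _ = _ := by rw [ht, mul_div_cancel₀ _ (by positivity)]

/-- The partial Fourier transform on `S^{(1)}`. -/
def partialFourier {D : ℝ} (hD : 1 ≤ D)
    (hL : ∀ w : W, ∃ c : F, ‖c‖ ≤ 1 ∧ ‖w‖ ≤ D * |L c w|) (H : GelfandShilov (E × F)) :
    GelfandShilov (E × W) :=
  ofBound (PartialFourier.partialFourier L μ H)
    (contDiff_infty.2 fun n => contDiff_partialFourier L μ n H.toSchwartz) fun h hh => by
      obtain ⟨h', hh', C, _, hC⟩ := exists_bound_partialFourier (E := E) L μ hD hL hh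
      obtain ⟨A, hA, hA'⟩ := H.exists_bound hh'
      exact ⟨C * A, hC H.toSchwartz A hA hA'⟩

end Fourier

end GelfandShilov

/-! ### Continuity criteria and bounded operators on S^{(1)} -/

namespace GelfandShilov

variable {E F X : Type} [NormedAddCommGroup E] [NormedSpace ℝ E]
  [NormedAddCommGroup F] [NormedSpace ℝ F] [NormedAddCommGroup X] [NormedSpace ℝ X]

section Duality

/-- Continuity involves finitely many norms. A bound for a smaller h is stronger, so the least of
their parameters controls all of them. -/
theorem exists_dual_bound (a : UltraDistribution E) :
    ∃ h : ℝ, 0 < h ∧ ∃ C : ℝ, 0 ≤ C ∧ ∀ (f : GelfandShilov E) (A : ℝ), 0 ≤ A → Bound h A f →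
      ‖a f‖ ≤ C * A := by
  obtain ⟨s, C, -, hC⟩ := Seminorm.bound_of_continuous withSeminorms
    ((normSeminorm ℂ ℂ).comp a.toLinearMap) (continuous_norm.comp a.continuous)
  obtain ⟨h, hh, hs⟩ : ∃ h : ℝ, 0 < h ∧ ∀ i ∈ s, h ≤ i.1 := by
    rcases s.eq_empty_or_nonempty with rfl | hne
    · exact ⟨1, one_pos, by simp⟩
    · obtain ⟨i, -, hi⟩ := s.exists_min_image (fun i => i.1) hne
      exact ⟨i.1, i.2, hi⟩
  refine ⟨h, hh, C, C.2, fun f A hA hf => (hC f).trans ?_⟩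
  refine mul_le_mul_of_nonneg_left (Seminorm.finset_sup_apply_le hA fun i hi => ?_) C.2
  exact hNorm_le (hf.anti hh.le (hs i hi) hA)

theorem continuous_of_dual_bound (T : GelfandShilov E →ₗ[ℂ] ℂ) {h C : ℝ} (hh : 0 < h)
    (hT : ∀ (f : GelfandShilov E) (A : ℝ), 0 ≤ A → Bound h A f → ‖T f‖ ≤ C * A) :
    Continuous T := by
  refine withSeminorms.continuous_normedSpace_rng ℂ T ⟨{⟨h, hh⟩}, C.toNNReal, fun f => ?_⟩
  refine (hT f (hNorm ⟨h, hh⟩ f) (apply_nonneg _ _) (bound_hNorm ⟨h, hh⟩ f)).trans ?_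
  rw [Finset.sup_singleton]
  exact mul_le_mul_of_nonneg_right (Real.le_coe_toNNReal C) (apply_nonneg _ _)

/-- In the strong topology smallness is tested uniformly on bounded sets. On such a set the h-norm
of g is at most some r, so |C| ‖f‖_h r bounds the values and tends to 0 with f. -/
theorem continuous_of_dual_bound₂ (T : GelfandShilov E →ₗ[ℂ] UltraDistribution F) {h C : ℝ}
    (hh : 0 < h) (hT : ∀ (f : GelfandShilov E) (g : GelfandShilov F) (A B : ℝ), 0 ≤ A → 0 ≤ B →
      Bound h A f → Bound h B g → ‖T f g‖ ≤ C * (A * B)) :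
    Continuous T := by
  refine continuous_of_continuousAt_zero T ?_
  rw [ContinuousAt, map_zero,
    (ContinuousLinearMap.hasBasis_nhds_zero_of_basis Metric.nhds_basis_ball).tendsto_right_iff]
  rintro ⟨S, ε⟩ ⟨hS, hε⟩
  obtain ⟨r, hr, hrS⟩ := (withSeminorms.isVonNBounded_iff_seminorm_bounded.1 hS) ⟨h, hh⟩
  have hc : Continuous (fun f : GelfandShilov E => hNorm ⟨h, hh⟩ f) :=
    withSeminorms.continuous_seminorm ⟨h, hh⟩
  have ht : Filter.Tendsto (fun f : GelfandShilov E => |C| * (hNorm ⟨h, hh⟩ f * r)) (nhds 0)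
      (nhds 0) := by
    have : Continuous fun f : GelfandShilov E => |C| * (hNorm ⟨h, hh⟩ f * r) := by fun_prop
    simpa using this.tendsto 0
  filter_upwards [ht.eventually_lt_const hε] with f hf g hg
  rw [mem_ball_zero_iff]
  refine lt_of_le_of_lt ?_ hf
  refine (hT f g _ _ (apply_nonneg _ _) (apply_nonneg _ _) (bound_hNorm ⟨h, hh⟩ f)
    (bound_hNorm ⟨h, hh⟩ g)).trans ?_
  refine mul_le_mul (le_abs_self C) ?_ (mul_nonneg (apply_nonneg _ _) (apply_nonneg _ _))
    (abs_nonneg C)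
  exact mul_le_mul_of_nonneg_left (hrS g hg).le (apply_nonneg _ _)

end Duality

/-- A map of test functions with norm bounds that are linear in the bound of the argument. -/
def BoundedOp (T : GelfandShilov E → GelfandShilov F) : Prop :=
  ∀ h : ℝ, 0 < h → ∃ h' : ℝ, 0 < h' ∧ ∃ C : ℝ, 0 ≤ C ∧ ∀ (f : GelfandShilov E) (A : ℝ), 0 ≤ A →
    Bound h' A f → Bound h (C * A) (T f)

theorem BoundedOp.comp {S : GelfandShilov F → GelfandShilov X}
    {T : GelfandShilov E → GelfandShilov F} (hS : BoundedOp S) (hT : BoundedOp T) :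
    BoundedOp fun f => S (T f) := by
  intro h hh
  obtain ⟨h₁, hh₁, C₁, hC₁, H₁⟩ := hS h hh
  obtain ⟨h₂, hh₂, C₂, hC₂, H₂⟩ := hT h₁ hh₁
  refine ⟨h₂, hh₂, C₁ * C₂, by positivity, fun f A hA hf => ?_⟩
  rw [mul_assoc]
  exact H₁ _ _ (by positivity) (H₂ f A hA hf)

theorem boundedOp_conjugate : BoundedOp (conjugate : GelfandShilov E → GelfandShilov E) :=
  fun h hh => ⟨h, hh, 1, zero_le_one, fun f A _ hf => by
    rw [one_mul]; exact Bound.conjugate hf⟩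

theorem boundedOp_compCLM (P : X →L[ℝ] E) {K : ℝ} (hK : 1 ≤ K) (hP : ‖P‖ ≤ K)
    (hPK : ∀ x, ‖x‖ ≤ K * ‖P x‖) :
    BoundedOp fun f : GelfandShilov E => compCLM f P hK hP hPK := fun h hh =>
  ⟨h / K, by positivity, 1, zero_le_one, fun f A _ hf => by
    rw [one_mul]; exact hf.comp_clm f.contDiff hK hP hPK⟩

theorem conjugate_apply (f : GelfandShilov E) (x : E) : f.conjugate x = conj (f x) := rfl

theorem add_apply (f g : GelfandShilov E) (x : E) : (f + g) x = f x + g x := rfl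

theorem smul_apply (c : ℂ) (f : GelfandShilov E) (x : E) : (c • f) x = c * f x := rfl

theorem conjugate_add (f g : GelfandShilov E) : (f + g).conjugate = f.conjugate + g.conjugate :=
  DFunLike.ext _ _ fun x => map_add (starRingEnd ℂ) (f x) (g x)

theorem conjugate_smul (c : ℂ) (f : GelfandShilov E) :
    (c • f).conjugate = conj c • f.conjugate :=
  DFunLike.ext _ _ fun x => map_mul (starRingEnd ℂ) c (f x)

/-- The pointwise product. -/
def mul (f g : GelfandShilov E) : GelfandShilov E :=
  mulComp f g (ContinuousLinearMap.id ℝ E) (ContinuousLinearMap.id ℝ E) le_rfl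
    ContinuousLinearMap.norm_id_le ContinuousLinearMap.norm_id_le (by simp)

@[simp]
theorem mul_apply (f g : GelfandShilov E) (x : E) : mul f g x = f x * g x := rfl

theorem Bound.mul {f g : GelfandShilov E} {h A B : ℝ} (hh : 0 < h) (hA : 0 ≤ A) (hB : 0 ≤ B)
    (hf : Bound (h / 2) A f) (hg : Bound (h / 2) B g) : Bound h (A * B) (mul f g) :=
  Bound.mul_comp f.contDiff g.contDiff (P := ContinuousLinearMap.id ℝ E)
    (Q := ContinuousLinearMap.id ℝ E) le_rfl ContinuousLinearMap.norm_id_le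
    ContinuousLinearMap.norm_id_le (by simp) hh hA hB (by simpa using hf) (by simpa using hg)

section ShearMul

/-- The map `(x, t) ↦ t - x`. -/
def sndSubFst : E × E →L[ℝ] E := ContinuousLinearMap.snd ℝ E E - ContinuousLinearMap.fst ℝ E E

theorem norm_sndSubFst_le : ‖(sndSubFst : E × E →L[ℝ] E)‖ ≤ 2 := by
  refine (norm_sub_le _ _).trans ?_
  have h1 := ContinuousLinearMap.norm_fst_le ℝ E E
  have h2 := ContinuousLinearMap.norm_snd_le ℝ E E
  linarith

theorem norm_le_two_mul_max_shear (x : E × E) :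
    ‖x‖ ≤ 2 * max ‖sndSubFst x‖ ‖ContinuousLinearMap.snd ℝ E E x‖ := by
  have h1 : ‖x.1‖ ≤ ‖x.2‖ + ‖x.2 - x.1‖ := by
    simpa using norm_sub_le x.2 (x.2 - x.1)
  have h2 := le_max_left ‖x.2 - x.1‖ ‖x.2‖
  have h3 := le_max_right ‖x.2 - x.1‖ ‖x.2‖
  have h4 := norm_nonneg x.2
  change max ‖x.1‖ ‖x.2‖ ≤ 2 * max ‖x.2 - x.1‖ ‖x.2‖
  exact max_le (by linarith) (by linarith)

/-- The test function `(x, t) ↦ f(t - x) g(t)`. -/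
def shearMul (f g : GelfandShilov E) : GelfandShilov (E × E) :=
  mulComp f g sndSubFst (ContinuousLinearMap.snd ℝ E E) one_le_two norm_sndSubFst_le
    ((ContinuousLinearMap.norm_snd_le ℝ E E).trans one_le_two) norm_le_two_mul_max_shear

@[simp]
theorem shearMul_apply (f g : GelfandShilov E) (p : E × E) :
    shearMul f g p = f (p.2 - p.1) * g p.2 := rfl

theorem boundedOp_shearMul (f : GelfandShilov E) : BoundedOp (shearMul f) := by
  intro h hh
  obtain ⟨A, hA, hfA⟩ := f.exists_bound (h := h / (2 * 2)) (by positivity)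
  exact ⟨h / (2 * 2), by positivity, A, hA, fun g B hB hg =>
    hfA.mul_comp f.contDiff g.contDiff one_le_two norm_sndSubFst_le
      ((ContinuousLinearMap.norm_snd_le ℝ E E).trans one_le_two) norm_le_two_mul_max_shear hh hA hB
      hg⟩

end ShearMul

section Fourier

variable {W : Type} [NormedAddCommGroup W] [NormedSpace ℝ W] (L : F →L[ℝ] W →L[ℝ] ℝ)
  [FiniteDimensional ℝ F] [MeasurableSpace F] [BorelSpace F] (μ : Measure F) [μ.IsAddHaarMeasure]
  {D : ℝ} (hD : 1 ≤ D) (hL : ∀ w : W, ∃ c : F, ‖c‖ ≤ 1 ∧ ‖w‖ ≤ D * |L c w|)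

theorem partialFourier_apply (H : GelfandShilov (E × F)) (z : E × W) :
    partialFourier L μ hD hL H z = ∫ t, Real.fourierChar (-(L t z.2)) • H (z.1, t) ∂μ := rfl

theorem boundedOp_partialFourier :
    BoundedOp (partialFourier L μ hD hL : GelfandShilov (E × F) → GelfandShilov (E × W)) := by
  intro h hh
  obtain ⟨h', hh', C, hC0, hC⟩ := exists_bound_partialFourier (E := E) L μ hD hL hh
  exact ⟨h', hh', C, hC0, fun f A hA hf => hC f.toSchwartz A hA hf⟩

theorem integrable_char_smul_slice (H : GelfandShilov (E × F)) (z : E × W) :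
    Integrable (fun t => Real.fourierChar (-(L t z.2)) • H (z.1, t)) μ :=
  PartialFourier.integrable_char_smul L μ (PartialFourier.integrable_slice μ H.toSchwartz z.1) z.2

theorem partialFourier_add (H G : GelfandShilov (E × F)) :
    partialFourier L μ hD hL (H + G) =
      partialFourier L μ hD hL H + partialFourier L μ hD hL G :=
  DFunLike.ext _ _ fun z => by
    simp only [add_apply, partialFourier_apply, smul_add]
    exact integral_add (integrable_char_smul_slice L μ H z) (integrable_char_smul_slice L μ G z)

theorem partialFourier_smul (c : ℂ) (H : GelfandShilov (E × F)) :
    partialFourier L μ hD hL (c • H) = c • partialFourier L μ hD hL H :=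
  DFunLike.ext _ _ fun z => by
    simp only [smul_apply, partialFourier_apply, ← integral_const_mul, mul_smul_comm]

end Fourier

/-! ### Correlation of test functions and convolution with an ultradistribution -/

section Convolution

variable [FiniteDimensional ℝ E] [MeasureSpace E] [BorelSpace E]
  [(volume : Measure E).IsAddHaarMeasure]

/-- The test function `z ↦ ∫ f(w - z) g(w) dw`. -/
def correlation (f g : GelfandShilov E) : GelfandShilov E :=
  -- With the zero pairing against a trivial frequency space the character is 1, so plain
  -- integration over w is a special partial Fourier transform and inherits its bounds.
  compCLM (partialFourier (W := PUnit) 0 volume le_rfl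
      (fun w => ⟨0, by simp, by simp [Subsingleton.elim w 0]⟩) (shearMul f g))
    (ContinuousLinearMap.inl ℝ E PUnit) le_rfl (ContinuousLinearMap.norm_inl_le_one ℝ E PUnit)
    (fun x => by simp)

theorem correlation_apply (f g : GelfandShilov E) (z : E) :
    correlation f g z = ∫ w, f (w - z) * g w := by
  change ∫ t, Real.fourierChar (-(0 : ℝ)) • (f (t - z) * g t) = _
  simp

theorem integrable_correlation (f g : GelfandShilov E) (z : E) :
    Integrable fun w => f (w - z) * g w :=
  PartialFourier.integrable_slice volume (shearMul f g).toSchwartz z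

theorem boundedOp_correlation (f : GelfandShilov E) : BoundedOp (correlation f) :=
  (boundedOp_compCLM (ContinuousLinearMap.inl ℝ E PUnit) le_rfl
    (ContinuousLinearMap.norm_inl_le_one ℝ E PUnit) (fun x => by simp)).comp
  ((boundedOp_partialFourier (W := PUnit) (E := E) (F := E) 0 volume le_rfl
    (fun w => ⟨0, by simp, by simp [Subsingleton.elim w 0]⟩)).comp (boundedOp_shearMul f))

theorem correlation_add (f g₁ g₂ : GelfandShilov E) :
    correlation f (g₁ + g₂) = correlation f g₁ + correlation f g₂ :=
  DFunLike.ext _ _ fun z => by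
    simp only [add_apply, correlation_apply, mul_add]
    exact integral_add (integrable_correlation f g₁ z) (integrable_correlation f g₂ z)

theorem correlation_smul (c : ℂ) (f g : GelfandShilov E) :
    correlation f (c • g) = c • correlation f g :=
  DFunLike.ext _ _ fun z => by
    simp only [smul_apply, correlation_apply, ← integral_const_mul, mul_left_comm]

/-- The convolution `a ∗ W`. -/
def convolution (a : UltraDistribution E) (W : GelfandShilov E) : UltraDistribution E where
  toFun Φ := a (correlation W Φ)
  map_add' f g := by rw [correlation_add, map_add]
  map_smul' c f := by rw [correlation_smul, map_smul]; rfl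
  cont := by
    obtain ⟨h, hh, C, hC, ha⟩ := exists_dual_bound a
    obtain ⟨h', hh', C', hC', hW⟩ := boundedOp_correlation W h hh
    refine continuous_of_dual_bound (C := C * C')
      { toFun := fun Φ => a (correlation W Φ)
        map_add' := fun f g => by rw [correlation_add, map_add]
        map_smul' := fun c f => by rw [correlation_smul, map_smul]; rfl } hh' fun f A hA hf => ?_
    rw [mul_assoc]
    exact ha _ _ (by positivity) (hW f A hA hf)

theorem isConvolution_convolution (a : UltraDistribution E) (W : GelfandShilov E) :
    IsConvolution a W (convolution a W) :=
  fun Φ => ⟨correlation W Φ, correlation_apply W Φ, rfl⟩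

end Convolution

end GelfandShilov

/-! ### A change of variables and Parseval's formula -/

theorem integral_integral_mul_shear {E : Type} [NormedAddCommGroup E] [NormedSpace ℝ E]
    [FiniteDimensional ℝ E] [MeasurableSpace E] [BorelSpace E] (μ : Measure E) [μ.IsAddHaarMeasure]
    {α β : E → ℂ} (hα : Integrable α μ) (hβ : Integrable β μ) (τ : ℝ) :
    ∫ p, ∫ t, β (p - (1 - τ) • t) * α (p + τ • t) ∂μ ∂μ = (∫ y, β y ∂μ) * ∫ r, α r ∂μ := by
  -- The substitution is factored as (t, p) ↦ (t, y) ↦ (y, y + t) with y = p - (1-τ)t. Both factors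
  -- preserve the product measure, and y + t = p + τt.
  have m1 : MeasurePreserving (fun z : E × E => (z.1, z.2 - (1 - τ) • z.1)) (μ.prod μ)
      (μ.prod μ) := by
    refine (MeasurePreserving.id μ).skew_product (g := fun t p => p - (1 - τ) • t)
      (by fun_prop) (Filter.Eventually.of_forall fun t => ?_)
    simpa using map_sub_right_eq_self μ ((1 - τ) • t)
  have m2 := (measurePreserving_prod_add_swap μ μ).comp m1
  have hG : Integrable (fun z : E × E => β z.1 * α z.2) (μ.prod μ) := hβ.mul_prod hα
  have e : ∀ t p : E, β (p - (1 - τ) • t) * α (p + τ • t) =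
      (fun z : E × E => β z.1 * α z.2)
        (((fun z : E × E => (z.2, z.2 + z.1)) ∘ fun z => (z.1, z.2 - (1 - τ) • z.1)) (t, p)) := by
    intro t p
    have : p - (1 - τ) • t + t = p + τ • t := by module
    simp [this]
  rw [← integral_prod_mul]
  refine (integral_congr_ae (ae_of_all _ fun p => integral_congr_ae (ae_of_all _ fun t =>
    e t p))).trans ?_
  refine (integral_prod_symm _ (m2.integrable_comp_of_integrable hG)).symm.trans ?_
  have h := integral_map (μ := μ.prod μ) m2.aemeasurable (f := fun z : E × E => β z.1 * α z.2)
    (by rw [m2.map_eq]; exact hG.aestronglyMeasurable)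
  rw [m2.map_eq] at h
  exact h.symm

/-- The Fourier transform is symmetric for the bilinear pairing, so it moves from u onto the inverse
transform of v, where inversion returns v. The integrability needed for inversion is obtained by
reflecting the inverse transform. -/
theorem integral_fourier_mul_fourierInv {E : Type} [NormedAddCommGroup E] [InnerProductSpace ℝ E]
    [FiniteDimensional ℝ E] [MeasurableSpace E] [BorelSpace E] {u v : E → ℂ} (hu : Integrable u)
    (hv : Integrable v) (hvc : Continuous v)
    (hv' : Integrable (FourierTransform.fourierInv v : E → ℂ)) :
    ∫ ξ, FourierTransform.fourier u ξ * FourierTransform.fourierInv v ξ = ∫ t, u t * v t := by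
  have hv'' : Integrable (FourierTransform.fourier v : E → ℂ) := by
    have : (FourierTransform.fourier v : E → ℂ) =
        fun x => (FourierTransform.fourierInv v : E → ℂ) (-x) := by
      funext x
      rw [Real.fourierInv_eq_fourier_neg, neg_neg]
    rw [this]
    exact hv'.comp_neg
  have h := VectorFourier.integral_fourierIntegral_smul_eq_flip (μ := (volume : Measure E))
    (ν := (volume : Measure E)) (L := innerₗ E) Real.continuous_fourierChar continuous_inner hu hv'
  rw [flip_innerₗ] at h
  have e := hvc.fourier_fourierInv_eq hv hv''
  simp only [smul_eq_mul] at h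
  refine Eq.trans h ?_
  refine integral_congr_ae (ae_of_all _ fun t => ?_)
  exact congrArg (u t * ·) (congrFun e t)

/-! ### Short-time Fourier transform, τ-Wigner distribution and Moyal's identity -/

namespace GelfandShilov

variable {d : ℕ}

instance isAddHaarMeasure_volume_prod :
    (volume : Measure (Rd d × Rd d)).IsAddHaarMeasure :=
  Measure.prod.instIsAddHaarMeasure volume volume

/-- The normalized vector w/‖w‖ detects the norm of w. This is the nondegeneracy required of the
pairing by `partialFourier`, with D = 1. -/
theorem exists_norm_le_inner {V : Type} [NormedAddCommGroup V] [InnerProductSpace ℝ V] (w : V) :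
    ∃ c : V, ‖c‖ ≤ 1 ∧ ‖w‖ ≤ 1 * |innerSL ℝ c w| := by
  rcases eq_or_ne w 0 with rfl | hw
  · exact ⟨0, by simp, by simp⟩
  · have hw' : ‖w‖ ≠ 0 := norm_ne_zero_iff.2 hw
    refine ⟨‖w‖⁻¹ • w, by rw [norm_smul, norm_inv, norm_norm, inv_mul_cancel₀ hw'], ?_⟩
    rw [innerSL_apply_apply, real_inner_smul_left, real_inner_self_eq_norm_sq, one_mul]
    field_simp
    exact le_abs_self _

/-- The partial Fourier transform on `ℝ^d × ℝ^d`. -/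
def fourierSnd (H : GelfandShilov (Rd d × Rd d)) : GelfandShilov (Rd d × Rd d) :=
  partialFourier (innerSL ℝ) volume le_rfl exists_norm_le_inner H

theorem fourierSnd_apply (H : GelfandShilov (Rd d × Rd d)) (x ξ : Rd d) :
    fourierSnd H (x, ξ) = ∫ t, Real.fourierChar (-(inner ℝ t ξ : ℝ)) • H (x, t) := rfl

theorem boundedOp_fourierSnd : BoundedOp (fourierSnd (d := d)) :=
  boundedOp_partialFourier (innerSL ℝ) volume le_rfl exists_norm_le_inner

theorem fourierChar_neg_smul (s : ℝ) (z : ℂ) :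
    Real.fourierChar (-s) • z = Complex.exp (-(2 * Real.pi * Complex.I * (s : ℝ))) * z := by
  rw [Circle.smul_def, Real.fourierChar_apply, smul_eq_mul]
  congr 2
  push_cast
  ring

/-- The short-time Fourier transform as a test function. -/
def shortTimeFourier (ψ f : GelfandShilov (Rd d)) : GelfandShilov (Rd d × Rd d) :=
  fourierSnd (shearMul ψ.conjugate f)

theorem shortTimeFourier_apply (ψ f : GelfandShilov (Rd d)) (x ξ : Rd d) :
    shortTimeFourier ψ f (x, ξ) = stft ψ f x ξ := by
  rw [shortTimeFourier, fourierSnd_apply, stft]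
  refine integral_congr_ae (ae_of_all _ fun t => ?_)
  simp only [fourierChar_neg_smul, shearMul_apply, conjugate_apply]
  ring

theorem boundedOp_shortTimeFourier (ψ : GelfandShilov (Rd d)) : BoundedOp (shortTimeFourier ψ) :=
  boundedOp_fourierSnd.comp (boundedOp_shearMul ψ.conjugate)

theorem shortTimeFourier_add (ψ f g : GelfandShilov (Rd d)) :
    shortTimeFourier ψ (f + g) = shortTimeFourier ψ f + shortTimeFourier ψ g := by
  have : shearMul ψ.conjugate (f + g) = shearMul ψ.conjugate f + shearMul ψ.conjugate g :=
    DFunLike.ext _ _ fun p => by simp only [shearMul_apply, add_apply, mul_add]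
  rw [shortTimeFourier, this]
  exact partialFourier_add _ _ _ _ _ _

theorem shortTimeFourier_smul (c : ℂ) (ψ f : GelfandShilov (Rd d)) :
    shortTimeFourier ψ (c • f) = c • shortTimeFourier ψ f := by
  have : shearMul ψ.conjugate (c • f) = c • shearMul ψ.conjugate f :=
    DFunLike.ext _ _ fun p => by simp only [shearMul_apply, smul_apply, mul_left_comm]
  rw [shortTimeFourier, this]
  exact partialFourier_smul _ _ _ _ _ _

section Wigner

/-- The map `(x, t) ↦ x + c t`. -/
def addSMul (c : ℝ) : Rd d × Rd d →L[ℝ] Rd d :=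
  ContinuousLinearMap.fst ℝ _ _ + c • ContinuousLinearMap.snd ℝ _ _

@[simp]
theorem addSMul_apply (c : ℝ) (p : Rd d × Rd d) : addSMul c p = p.1 + c • p.2 := rfl

theorem norm_addSMul_le {c : ℝ} (hc : |c| ≤ 1) : ‖(addSMul c : Rd d × Rd d →L[ℝ] Rd d)‖ ≤ 2 := by
  refine (norm_add_le _ _).trans ?_
  rw [norm_smul, Real.norm_eq_abs]
  have h1 := ContinuousLinearMap.norm_fst_le ℝ (Rd d) (Rd d)
  have h2 := ContinuousLinearMap.norm_snd_le ℝ (Rd d) (Rd d)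
  have h3 := mul_le_one₀ hc (norm_nonneg _) h2
  linarith

/-- The first component is a convex combination of the two images, as τ ∈ [0, 1], and the second is
their difference. -/
theorem norm_le_two_mul_max_addSMul {τ : ℝ} (hτ : τ ∈ Set.Icc (0 : ℝ) 1) (p : Rd d × Rd d) :
    ‖p‖ ≤ 2 * max ‖addSMul τ p‖ ‖addSMul (-(1 - τ)) p‖ := by
  have e1 : p.1 = (1 - τ) • addSMul τ p + τ • addSMul (-(1 - τ)) p := by
    simp only [addSMul_apply]; module
  have e2 : p.2 = addSMul τ p - addSMul (-(1 - τ)) p := by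
    simp only [addSMul_apply]; module
  have m1 := le_max_left ‖addSMul τ p‖ ‖addSMul (-(1 - τ)) p‖
  have m2 := le_max_right ‖addSMul τ p‖ ‖addSMul (-(1 - τ)) p‖
  set m := max ‖addSMul τ p‖ ‖addSMul (-(1 - τ)) p‖
  have hm : 0 ≤ m := (norm_nonneg _).trans m1
  have h1 : ‖p.1‖ ≤ m := by
    rw [e1]
    refine (norm_add_le _ _).trans ?_
    rw [norm_smul, norm_smul, Real.norm_of_nonneg (by linarith [hτ.2] : 0 ≤ 1 - τ),
      Real.norm_of_nonneg hτ.1]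
    have := mul_le_mul_of_nonneg_left m1 (by linarith [hτ.2] : 0 ≤ 1 - τ)
    have := mul_le_mul_of_nonneg_left m2 hτ.1
    linarith
  have h2 : ‖p.2‖ ≤ 2 * m := by
    rw [e2]
    refine (norm_sub_le _ _).trans ?_
    linarith
  exact max_le (by linarith) h2

variable {τ : ℝ} (hτ : τ ∈ Set.Icc (0 : ℝ) 1)

/-- The test function `(x, t) ↦ f(x + τ t) conj(g(x - (1 - τ) t))`. -/
def wignerProduct (f g : GelfandShilov (Rd d)) : GelfandShilov (Rd d × Rd d) :=
  mulComp f g.conjugate (addSMul τ) (addSMul (-(1 - τ))) one_le_two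
    (norm_addSMul_le (abs_le.2 ⟨by linarith [hτ.1], hτ.2⟩))
    (norm_addSMul_le (abs_le.2 ⟨by linarith [hτ.1], by linarith [hτ.2]⟩))
    (norm_le_two_mul_max_addSMul hτ)

theorem wignerProduct_apply (f g : GelfandShilov (Rd d)) (x t : Rd d) :
    wignerProduct hτ f g (x, t) = f (x + τ • t) * conj (g (x - (1 - τ) • t)) := by
  rw [sub_eq_add_neg, ← neg_smul]
  rfl

/-- The cross-`τ`-Wigner distribution as a test function. -/
def wigner (f g : GelfandShilov (Rd d)) : GelfandShilov (Rd d × Rd d) :=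
  fourierSnd (wignerProduct hτ f g)

theorem wigner_apply (f g : GelfandShilov (Rd d)) (x ξ : Rd d) :
    wigner hτ f g (x, ξ) = tauWigner τ f g x ξ := by
  rw [wigner, fourierSnd_apply, tauWigner]
  refine integral_congr_ae (ae_of_all _ fun t => ?_)
  simp only [fourierChar_neg_smul, wignerProduct_apply]
  ring

/-- Links the Wigner distribution to quantization: the integral is the test function paired with the
symbol in `IsTauQuantization`. -/
theorem conjugate_wigner_apply (f g : GelfandShilov (Rd d)) (p ξ : Rd d) :
    (wigner hτ g f).conjugate (p, ξ) =
      ∫ s, Complex.exp (2 * Real.pi * Complex.I * (inner ℝ s ξ : ℝ)) *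
        f (p - (1 - τ) • s) * conj (g (p + τ • s)) := by
  rw [conjugate_apply, wigner_apply, tauWigner, ← integral_conj]
  refine integral_congr_ae (ae_of_all _ fun s => ?_)
  simp only [map_mul, Complex.conj_conj, ← Complex.exp_conj, map_neg, Complex.conj_I,
    Complex.conj_ofReal, map_ofNat]
  rw [mul_neg, neg_mul, neg_neg]
  ring

/-- A frequency translation by ξ is a modulation under the Fourier integral. This puts the
η-integral of Moyal's identity in the form required by Parseval. -/
theorem wigner_sub_eq_fourier (f g : GelfandShilov (Rd d)) (x ξ p η : Rd d) :
    wigner hτ f g ((p, η) - (x, ξ)) = FourierTransform.fourier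
      (fun t => Real.fourierChar (inner ℝ t ξ) • wignerProduct hτ f g (p - x, t)) η := by
  rw [Prod.mk_sub_mk, wigner, fourierSnd_apply, Real.fourier_eq]
  refine integral_congr_ae (ae_of_all _ fun t => ?_)
  simp only
  rw [smul_smul, ← AddChar.map_add_eq_mul, inner_sub_right]
  congr 2
  ring

theorem conjugate_wigner_eq_fourierInv (f g : GelfandShilov (Rd d)) (p η : Rd d) :
    (wigner hτ g f).conjugate (p, η) = FourierTransform.fourierInv
      (fun t => (wignerProduct hτ g f).conjugate (p, t)) η := by
  rw [conjugate_wigner_apply, Real.fourierInv_eq]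
  refine integral_congr_ae (ae_of_all _ fun t => ?_)
  have h := fourierChar_neg_smul (-(inner ℝ t η)) ((wignerProduct hτ g f).conjugate (p, t))
  rw [neg_neg] at h
  refine Eq.trans ?_ h.symm
  simp only [conjugate_apply, wignerProduct_apply, map_mul, Complex.conj_conj, Complex.ofReal_neg,
    mul_neg, neg_neg]
  ring

/-- Moyal's identity. -/
theorem correlation_wigner (φ₁ φ₂ f g : GelfandShilov (Rd d)) :
    correlation (wigner hτ φ₂ φ₁) (wigner hτ g f).conjugate =
      mul (shortTimeFourier φ₁ f) (shortTimeFourier φ₂ g).conjugate := by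
  refine DFunLike.ext _ _ fun ⟨x, ξ⟩ => ?_
  have hint : ∀ (H : GelfandShilov (Rd d × Rd d)) y, Integrable fun t => H (y, t) :=
    fun H y => PartialFourier.integrable_slice volume H.toSchwartz y
  -- α' and β are the integrands of V_{φ₂}g and V_{φ₁}f at (x, ξ).
  set α' : Rd d → ℂ := fun r =>
    Real.fourierChar (-(inner ℝ r ξ : ℝ)) • shearMul φ₂.conjugate g (x, r) with hα'
  set β : Rd d → ℂ := fun y =>
    Real.fourierChar (-(inner ℝ y ξ : ℝ)) • shearMul φ₁.conjugate f (x, y) with hβ'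
  have hα : Integrable α' := integrable_char_smul_slice (innerSL ℝ) volume _ (x, ξ)
  have hβ : Integrable β := integrable_char_smul_slice (innerSL ℝ) volume _ (x, ξ)
  have hαc : Integrable fun r => conj (α' r) := Complex.conjCLE.integrable_comp_iff.2 hα
  have h0 := integrable_correlation (wigner hτ φ₂ φ₁) (wigner hτ g f).conjugate (x, ξ)
  rw [correlation_apply]
  rw [Measure.volume_eq_prod] at h0 ⊢
  rw [integral_prod _ h0, mul_apply, conjugate_apply]
  have hsh := integral_integral_mul_shear volume hαc hβ τ
  rw [integral_conj] at hsh
  refine Eq.trans ?_ hsh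
  refine integral_congr_ae (ae_of_all _ fun p => ?_)
  simp only [wigner_sub_eq_fourier, conjugate_wigner_eq_fourierInv]
  -- Parseval in η at fixed p leaves an integral over t of β(p - (1-τ)t) · conj α'(p + τt).
  rw [integral_fourier_mul_fourierInv]
  · refine integral_congr_ae (ae_of_all _ fun t => ?_)
    simp only [hα', hβ', conjugate_apply, wignerProduct_apply, shearMul_apply]
    have hp : p + τ • t = (p - (1 - τ) • t) + t := by module
    have h1 : p - x + τ • t = p + τ • t - x := by abel
    have h2 : p - x - (1 - τ) • t = p - (1 - τ) • t - x := by abel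
    -- Since t is the difference of p + τt and p - (1-τ)t, the modulation splits into one character
    -- for each short-time Fourier transform.
    have hexp : (Real.fourierChar (inner ℝ t ξ) : ℂ) =
        Real.fourierChar (-(inner ℝ (p - (1 - τ) • t) ξ)) *
          conj (Real.fourierChar (-(inner ℝ (p + τ • t) ξ)) : ℂ) := by
      rw [← Circle.coe_inv_eq_conj, ← AddChar.map_neg_eq_inv, neg_neg, ← Circle.coe_mul,
        ← AddChar.map_add_eq_mul, hp, inner_add_left, neg_add_cancel_left]
    simp only [Circle.smul_def, smul_eq_mul, map_mul, Complex.conj_conj, h1, h2, hexp]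
    ring
  -- The modulation has the opposite sign to the Fourier kernel, hence the negated pairing.
  · have := PartialFourier.integrable_char_smul (-innerSL ℝ) volume
      (hint (wignerProduct hτ φ₂ φ₁) (p - x)) ξ
    simpa [innerSL_apply_apply ℝ] using this
  · exact hint _ p
  · exact (contDiff (wignerProduct hτ g f).conjugate).continuous.comp (by fun_prop)
  · have := hint (wigner hτ g f).conjugate p
    simpa only [conjugate_wigner_eq_fourierInv] using this

end Wigner

/-! ### Localization operators and their symbols -/

section Localization

/-- The test function `V_{φ₁} f · conj(V_{φ₂} g)`. -/
def stftProduct (φ₁ φ₂ f g : GelfandShilov (Rd d)) : GelfandShilov (Rd d × Rd d) :=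
  -- Conjugating g makes the product linear in g, as a functional requires; `bracket` evaluates the
  -- functional at the conjugate and so undoes this.
  mul (shortTimeFourier φ₁ f) (shortTimeFourier φ₂ g.conjugate).conjugate

theorem exists_stftProduct_bound (a : UltraDistribution (Rd d × Rd d))
    (φ₁ φ₂ : GelfandShilov (Rd d)) :
    ∃ h : ℝ, 0 < h ∧ ∃ C : ℝ, 0 ≤ C ∧ ∀ (f g : GelfandShilov (Rd d)) (A B : ℝ), 0 ≤ A → 0 ≤ B →
      Bound h A f → Bound h B g → ‖a (stftProduct φ₁ φ₂ f g)‖ ≤ C * (A * B) := by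
  obtain ⟨h, hh, C, hC, ha⟩ := exists_dual_bound a
  obtain ⟨h₁, hh₁, C₁, hC₁, H₁⟩ := boundedOp_shortTimeFourier φ₁ (h / 2) (by positivity)
  obtain ⟨h₂, hh₂, C₂, hC₂, H₂⟩ := (boundedOp_conjugate.comp
    ((boundedOp_shortTimeFourier φ₂).comp boundedOp_conjugate)) (h / 2) (by positivity)
  refine ⟨min h₁ h₂, lt_min hh₁ hh₂, C * (C₁ * C₂), by positivity, fun f g A B hA hB hf hg => ?_⟩
  have hm : 0 ≤ min h₁ h₂ := (lt_min hh₁ hh₂).le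
  refine (ha _ _ (by positivity) (Bound.mul hh (by positivity) (by positivity)
    (H₁ f A hA (hf.anti hm (min_le_left _ _) hA))
    (H₂ g B hB (hg.anti hm (min_le_right _ _) hB)))).trans (le_of_eq ?_)
  ring

/-- The localization operator, as a linear map into linear functionals. -/
def localizationForm (a : UltraDistribution (Rd d × Rd d)) (φ₁ φ₂ : GelfandShilov (Rd d)) :
    GelfandShilov (Rd d) →ₗ[ℂ] GelfandShilov (Rd d) →ₗ[ℂ] ℂ :=
  LinearMap.mk₂ ℂ (fun f g => a (stftProduct φ₁ φ₂ f g))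
    (fun f f' g => by
      rw [← map_add]
      congr 1
      refine DFunLike.ext _ _ fun z => ?_
      simp only [stftProduct, shortTimeFourier_add, mul_apply, add_apply, add_mul])
    (fun c f g => by
      rw [← map_smul]
      congr 1
      refine DFunLike.ext _ _ fun z => ?_
      simp only [stftProduct, shortTimeFourier_smul, mul_apply, smul_apply, mul_assoc])
    (fun f g g' => by
      rw [← map_add]
      congr 1
      refine DFunLike.ext _ _ fun z => ?_
      simp only [stftProduct, conjugate_add, shortTimeFourier_add, mul_apply, add_apply, mul_add])
    (fun c f g => by
      rw [← map_smul]
      congr 1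
      refine DFunLike.ext _ _ fun z => ?_
      simp only [stftProduct, conjugate_smul, shortTimeFourier_smul, mul_apply, smul_apply,
        Complex.conj_conj, mul_left_comm])

theorem continuous_localizationForm (a : UltraDistribution (Rd d × Rd d))
    (φ₁ φ₂ f : GelfandShilov (Rd d)) : Continuous (localizationForm a φ₁ φ₂ f) := by
  obtain ⟨h, hh, C, hC, H⟩ := exists_stftProduct_bound a φ₁ φ₂
  obtain ⟨A, hA, hfA⟩ := f.exists_bound hh
  refine continuous_of_dual_bound (C := C * A) _ hh fun g B hB hg => ?_
  rw [mul_assoc]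
  exact H f g A B hA hB hfA hg

/-- The localization operator. -/
def localizationOperator (a : UltraDistribution (Rd d × Rd d)) (φ₁ φ₂ : GelfandShilov (Rd d)) :
    GelfandShilov (Rd d) →L[ℂ] UltraDistribution (Rd d) :=
  let T : GelfandShilov (Rd d) →ₗ[ℂ] UltraDistribution (Rd d) :=
    { toFun := fun f => ⟨localizationForm a φ₁ φ₂ f, continuous_localizationForm a φ₁ φ₂ f⟩
      map_add' := fun f f' => by ext g; simp
      map_smul' := fun c f => by ext g; simp }
  ⟨T, by
    obtain ⟨h, hh, C, hC, H⟩ := exists_stftProduct_bound a φ₁ φ₂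
    exact continuous_of_dual_bound₂ T hh H⟩

theorem bracket_localizationOperator (a : UltraDistribution (Rd d × Rd d))
    (φ₁ φ₂ f g : GelfandShilov (Rd d)) :
    bracket (localizationOperator a φ₁ φ₂ f) g =
      a (mul (shortTimeFourier φ₁ f) (shortTimeFourier φ₂ g).conjugate) := by
  change a (stftProduct φ₁ φ₂ f g.conjugate) = _
  rw [stftProduct, conjugate_conjugate]

theorem isLocalizationOperator (a : UltraDistribution (Rd d × Rd d))
    (φ₁ φ₂ : GelfandShilov (Rd d)) :
    IsLocalizationOperator a φ₁ φ₂ (localizationOperator a φ₁ φ₂) := by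
  intro f g
  refine ⟨mul (shortTimeFourier φ₁ f).conjugate (shortTimeFourier φ₂ g), fun x ξ => ?_, ?_⟩
  · rw [mul_apply, conjugate_apply, shortTimeFourier_apply, shortTimeFourier_apply]
  · rw [bracket_localizationOperator, bracket]
    congr 1
    refine DFunLike.ext _ _ fun z => ?_
    simp only [mul_apply, conjugate_apply, map_mul, Complex.conj_conj]

/-- The convolution applied to conj W_τ(g, f) is a applied to a correlation, and Moyal's identity
turns that correlation into the product defining the localization operator. -/
theorem isTauQuantization_localizationOperator {τ : ℝ} (hτ : τ ∈ Set.Icc (0 : ℝ) 1)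
    (a : UltraDistribution (Rd d × Rd d)) (φ₁ φ₂ : GelfandShilov (Rd d)) :
    IsTauQuantization τ (convolution a (wigner hτ φ₂ φ₁)) (localizationOperator a φ₁ φ₂) := by
  intro f g
  refine ⟨(wigner hτ g f).conjugate, conjugate_wigner_apply hτ f g, ?_⟩
  rw [bracket_localizationOperator, ← correlation_wigner hτ]
  rfl

end Localization

end GelfandShilov

end

/-- One operator satisfies both characterizations, so the equality is definitional. By
`IsLocalizationOperator.unique`, `IsConvolution.unique` and `IsTauQuantization.unique` the
characterizations determine their objects, so nothing is lost by exhibiting these witnesses. -/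
theorem mainTheorem5 (d : ℕ) (τ : ℝ) (hτ : τ ∈ Set.Icc (0 : ℝ) 1)
    (φ₁ φ₂ : GelfandShilov (Rd d)) (hφ₁ : φ₁ ≠ 0) (hφ₂ : φ₂ ≠ 0)
    (a : UltraDistribution (Rd d × Rd d)) :
    ∃ (A : GelfandShilov (Rd d) →L[ℂ] UltraDistribution (Rd d))
      (W : GelfandShilov (Rd d × Rd d)) (σ : UltraDistribution (Rd d × Rd d))
      (B : GelfandShilov (Rd d) →L[ℂ] UltraDistribution (Rd d)),
      IsLocalizationOperator a φ₁ φ₂ A ∧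
      (∀ x ξ, W (x, ξ) = tauWigner τ φ₂ φ₁ x ξ) ∧
      IsConvolution a W σ ∧
      IsTauQuantization τ σ B ∧
      A = B :=
  ⟨GelfandShilov.localizationOperator a φ₁ φ₂, GelfandShilov.wigner hτ φ₂ φ₁,
    GelfandShilov.convolution a (GelfandShilov.wigner hτ φ₂ φ₁),
    GelfandShilov.localizationOperator a φ₁ φ₂,
    GelfandShilov.isLocalizationOperator a φ₁ φ₂, GelfandShilov.wigner_apply hτ φ₂ φ₁,
    GelfandShilov.isConvolution_convolution a _,
    GelfandShilov.isTauQuantization_localizationOperator hτ a φ₁ φ₂, rfl⟩
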